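/- Let $A$ be a separable unital $C^*$-algebra (with $1\neq 0$), and let $\alpha\colon\mathbb{T}\to\operatorname{Aut}(A)$ be an action of the circle that is continuous for the topology of pointwise norm convergence. Suppose that $\alpha$ has the Rokhlin property: for every finite set $F\subseteq A$ and every $\varepsilon>0$ there is a unitary $u\in A$ with $\|\alpha_\zeta(u)-\zeta u\|<\varepsilon$ for all $\zeta\in\mathbb{T}$ and $\|ua-au\|<\varepsilon$ for all $a\in F$. For an integer $n\geq 1$ let $\alpha|_{\mathbb{Z}_n}$ be the restriction of $\alpha$ to $\mathbb{Z}_n$, identified with the group of $n$-th roots of unity in $\mathbb{T}$. Let $\mathcal{Q}=\varinjlim_n M_{n!}(\mathbb{C})$ be the universal UHF algebra, that is, the UHF algebra with $(K_0(\mathcal{Q}),[1])\cong(\mathbb{Q},1)$, and let $\mathcal{O}_2$ be the Cuntz algebra generated by two isometries $s_1,s_2$ with $s_1s_1^*+s_2s_2^*=1$. (1) If $A$ absorbs $\mathcal{Q}$ tensorially, i.e. $A\otimes\mathcal{Q}\cong A$, then for every $n\geq 1$ the action $\alpha|_{\mathbb{Z}_n}$ has the Rokhlin property: for every finite set $F\subseteq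 A$ and every $\varepsilon>0$ there are pairwise orthogonal projections $e_g\in A$, $g\in\mathbb{Z}_n$, such that $\|\alpha_g(e_h)-e_{gh}\|<\varepsilon$ for all $g,h\in\mathbb{Z}_n$, $\|e_ga-ae_g\|<\varepsilon$ for all $g\in\mathbb{Z}_n$ and $a\in F$, and $\sum_{g\in\mathbb{Z}_n}e_g=1$. (2) In particular, if $A$ absorbs $\mathcal{O}_2$ tensorially, i.e. $A\otimes\mathcal{O}_2\cong A$, then $\alpha|_{\mathbb{Z}_n}$ has the Rokhlin property for every $n\geq 1$. -/

import Mathlib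

open scoped TensorProduct

noncomputable section

/-! ### Concrete operators on `ℓ²(ℕ)` -/

/-- The Hilbert space `ℓ²(ℕ)`. -/
abbrev EllTwo : Type := lp (fun _ : ℕ => ℂ) 2

/-- The standard orthonormal basis `(e_k)` of `ℓ²(ℕ)`. -/
def stdBasis : HilbertBasis ℕ ℂ EllTwo := ⟨LinearIsometryEquiv.refl ℂ EllTwo⟩

theorem injective_mul_add {n : ℕ} (i : Fin n) : Function.Injective fun k : ℕ => n * k + i := by
  intro a b h
  have hn : 0 < n := lt_of_le_of_lt (Nat.zero_le _) i.isLt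
  exact Nat.eq_of_mul_eq_mul_left hn (Nat.add_right_cancel h)

theorem orthonormal_stdBasis_mul_add {n : ℕ} (i : Fin n) :
    Orthonormal ℂ fun k : ℕ => stdBasis (n * k + i) :=
  stdBasis.orthonormal.comp _ (injective_mul_add i)

/-- For `0 ≤ i < n`, the isometry `V_{n,i}` of `ℓ²(ℕ)` with `V_{n,i} e_k = e_{nk+i}`. -/
def blockIsometry (n : ℕ) (i : Fin n) : EllTwo →L[ℂ] EllTwo :=
  (orthonormal_stdBasis_mul_add i).orthogonalFamily.linearIsometry.toContinuousLinearMap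

theorem blockIsometry_apply_stdBasis (n : ℕ) (i : Fin n) (k : ℕ) :
    blockIsometry n i (stdBasis k) = stdBasis (n * k + i) := by
  have h := (orthonormal_stdBasis_mul_add i).orthogonalFamily.linearIsometry_apply_single
    (i := k) (1 : ℂ)
  have e : stdBasis k = lp.single 2 k (1 : ℂ) := (stdBasis.repr_symm_single k).symm
  rw [e]
  refine h.trans ?_
  simp

/-! ### The universal UHF algebra and the Cuntz algebra `𝒪₂` -/

/-- The universal UHF algebra `𝒬 = lim M_{n!}`, as a concrete C*-algebra: the norm closure of the
*-algebra of operators on `ℓ²(ℕ)` generated by all `V_{n,i} V_{n,j}^*`, `n ≥ 1`, `0 ≤ i, j < n`.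
For fixed `n` these operators are the matrix units `e_{nq+j} ↦ e_{nq+i}` (and `e_{nq+l} ↦ 0` for
`l ≠ j`, `0 ≤ l < n`) of a unital copy of `M_n`, and since
`V_{n,i} V_{n,j}^* = ∑_{r < m} V_{nm,nr+i} V_{nm,nr+j}^*`, the copy of `M_n` sits unitally in that of
`M_{nm}`; so this is the closure of the increasing union of the unital matrix algebras `M_{n!}`. -/
def universalUHF : StarSubalgebra ℂ (EllTwo →L[ℂ] EllTwo) :=
  (StarAlgebra.adjoin ℂ
    {T | ∃ (n : ℕ) (i j : Fin n), T = blockIsometry n i * star (blockIsometry n j)}).topologicalClosure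

instance : CStarAlgebra universalUHF :=
  StarSubalgebra.cstarAlgebra universalUHF
    (h_closed := StarSubalgebra.isClosed_topologicalClosure _)

/-- The Cuntz algebra `𝒪₂`, as the C*-algebra generated by the two isometries `s₁ e_k = e_{2k}` and
`s₂ e_k = e_{2k+1}` of `ℓ²(ℕ)`, which satisfy `s₁ s₁^* + s₂ s₂^* = 1`. (By Cuntz's uniqueness theorem
any two isometries with this relation generate the same C*-algebra up to isomorphism.) -/
def cuntzTwo : StarSubalgebra ℂ (EllTwo →L[ℂ] EllTwo) :=
  (StarAlgebra.adjoin ℂ {blockIsometry 2 0, blockIsometry 2 1}).topologicalClosure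

instance : CStarAlgebra cuntzTwo :=
  StarSubalgebra.cstarAlgebra cuntzTwo
    (h_closed := StarSubalgebra.isClosed_topologicalClosure _)

/-! ### C*-tensor products and absorption -/

/-- `C`, with the unital *-homomorphisms `i : A → C` and `j : D → C`, is a C*-tensor product of the
unital C*-algebras `A` and `D`: the ranges commute, and the induced map `a ⊗ d ↦ i a * j d` identifies
the algebraic tensor product with a dense *-subalgebra of `C`. In other words `C` is the completion of
`A ⊙ D` in a C*-norm. If `D` is nuclear there is exactly one such norm, so that
`C` is `A ⊗ D`. -/
structure IsCStarTensorProduct {A D C : Type*} [CStarAlgebra A] [CStarAlgebra D] [CStarAlgebra C]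
    (i : A →⋆ₐ[ℂ] C) (j : D →⋆ₐ[ℂ] C) : Prop where
  commute : ∀ a d, Commute (i a) (j d)
  injective : Function.Injective (Algebra.TensorProduct.lift i.toAlgHom j.toAlgHom commute)
  denseRange : DenseRange (Algebra.TensorProduct.lift i.toAlgHom j.toAlgHom commute)

/-- `A` absorbs the (nuclear) C*-algebra `D` tensorially: `A ⊗ D ≅ A`. -/
def TensoriallyAbsorbs.{u, v} (A : Type u) (D : Type v) [CStarAlgebra A] [CStarAlgebra D] : Prop :=
  ∃ (C : Type u) (_ : CStarAlgebra C) (i : A →⋆ₐ[ℂ] C) (j : D →⋆ₐ[ℂ] C),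
    IsCStarTensorProduct i j ∧ Nonempty (C ≃⋆ₐ[ℂ] A)

/-! ### The Rokhlin property -/

/-- The Rokhlin property for an action of a finite group `G` on a unital C*-algebra. -/
def FiniteRokhlinProperty {G A : Type*} [Group G] [Fintype G] [CStarAlgebra A]
    (α : G →* (A ≃⋆ₐ[ℂ] A)) : Prop :=
  ∀ (F : Finset A) (ε : ℝ), 0 < ε → ∃ e : G → A,
    (∀ g, IsStarProjection (e g)) ∧
    (∀ g h, g ≠ h → e g * e h = 0) ∧
    (∀ g h, ‖α g (e h) - e (g * h)‖ < ε) ∧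
    (∀ g, ∀ a ∈ F, ‖e g * a - a * e g‖ < ε) ∧
    ∑ g, e g = 1

/-- The Rokhlin property for an action of the circle on a unital C*-algebra. -/
def CircleRokhlinProperty {A : Type*} [CStarAlgebra A] (α : Circle →* (A ≃⋆ₐ[ℂ] A)) : Prop :=
  ∀ (F : Finset A) (ε : ℝ), 0 < ε → ∃ u ∈ unitary A,
    (∀ ζ : Circle, ‖α ζ u - (ζ : ℂ) • u‖ < ε) ∧
    (∀ a ∈ F, ‖u * a - a * u‖ < ε)

/-- The restriction of a circle action to `ℤ_n`, embedded in the circle as the `n`-th roots of unity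
by `j ↦ exp(2πij/n)`. -/
def restrictCyclic {A : Type*} [CStarAlgebra A] (α : Circle →* (A ≃⋆ₐ[ℂ] A)) (n : ℕ) [NeZero n] :
    Multiplicative (ZMod n) →* (A ≃⋆ₐ[ℂ] A) :=
  α.comp (ZMod.toCircle (N := n)).toMonoidHom

end

/-!
A Rokhlin unitary `u` for the circle action moves under `α_ζ` approximately like the coordinate
function. With `b_λ = N⁻¹ ∑_{j<N} (λu)^j`, `λ^N = 1`, the elements `b_λ^* b_λ` are the values at `u` of
a partition of unity by Fejér kernels, and a loop `f` in `A` is compressed to the single element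
`∑_λ b_λ^* f(λ) b_λ`; on loops that almost commute with `u` this is almost multiplicative.

Suppose that every finite set of `A` almost commutes with some unital copy of `M_n`. The rank-one
projections `p(ζ)` of `M_n` onto the lines spanned by `(1, ζ, …, ζ^{n-1})`, with `ζ` running through
a coset of the `n`-th roots of unity, are orthogonal with sum `1`. Compressing the loops
`ζ ↦ α_ζ(p(ζ ω_g⁻¹))`, where `ω_g` is the root of unity attached to `g ∈ ℤ_n`, gives elements that are
almost orthogonal projections with sum `1`, almost central and almost permuted by `α|_{ℤ_n}`;
stability of the relations makes them exact.

It remains to see that `𝒬` and `𝒪₂` have such almost central copies of `M_n`, for then so has every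
algebra absorbing one of them. In `𝒬` the matrix units of `M_n` amplified by `M_m` commute with
`M_m`. In `𝒪₂`, words `t_1, …, t_n` in the generators form a Cuntz family with matrix units
`t_i t_j^*`, and the canonical endomorphism `σ(x) = ∑ s_i x s_i^*` moves these by conjugation with the
unitary `∑ σ(t_i) t_i^*`. Now `σ` has Rokhlin towers, which come from a projection that `σ` almost
flips, and the unitaries of this cocycle have finite spectrum, so they are joined to `1` by short
steps; hence the cocycle is almost a coboundary. Conjugating accordingly makes the matrix units almost
fixed by `σ`, and since `σ(x) s_i = s_i x` they then almost commute with the generators.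
-/

section ColumnNorms

theorem norm_mul_le_of_norm_le_one_left {A : Type*} [NonUnitalSeminormedRing A] {a : A}
    (ha : ‖a‖ ≤ 1) (x : A) : ‖a * x‖ ≤ ‖x‖ :=
  (norm_mul_le _ _).trans (mul_le_of_le_one_left (norm_nonneg _) ha)

theorem norm_mul_le_of_norm_le_one_right {A : Type*} [NonUnitalSeminormedRing A] {a : A}
    (ha : ‖a‖ ≤ 1) (x : A) : ‖x * a‖ ≤ ‖x‖ :=
  (norm_mul_le _ _).trans (mul_le_of_le_one_right (norm_nonneg _) ha)

variable {A ι : Type*} [NonUnitalCStarAlgebra A] [Fintype ι]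

theorem norm_sum_star_mul_le_sqrt_mul_sqrt (x y : ι → A) :
    ‖∑ i, star (x i) * y i‖ ≤ √‖∑ i, star (x i) * x i‖ * √‖∑ i, star (y i) * y i‖ := by
  let _ := CStarAlgebra.spectralOrder A
  let _ := CStarAlgebra.spectralOrderedRing A
  let toModule (z : ι → A) : WithCStarModule A (ι → A) :=
    (WithCStarModule.equiv A (ι → A)).symm fun i => star (z i)
  have inner_toModule (z w : ι → A) :
      inner A (toModule z) (toModule w) = ∑ i, star (w i) * z i := by
    simp [toModule, WithCStarModule.pi_inner, WithCStarModule.inner_def]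
  have h := CStarModule.norm_inner_le (A := A) (WithCStarModule A (ι → A))
    (x := toModule y) (y := toModule x)
  rwa [CStarModule.norm_eq_sqrt_norm_inner_self (A := A) (toModule x),
    CStarModule.norm_eq_sqrt_norm_inner_self (A := A) (toModule y), inner_toModule,
    inner_toModule, inner_toModule, mul_comm] at h

theorem norm_sum_star_mul_self_mul_le (X d : ι → A) {t : ι → ℝ} (hX : ∀ i, ‖X i‖ ^ 2 ≤ t i) :
    ‖∑ i, star (X i * d i) * (X i * d i)‖ ≤ ‖∑ i, t i • (star (d i) * d i)‖ := by
  let _ := CStarAlgebra.spectralOrder A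
  let _ := CStarAlgebra.spectralOrderedRing A
  refine CStarAlgebra.norm_le_norm_of_nonneg_of_le
    (Finset.sum_nonneg fun i _ => star_mul_self_nonneg _) (Finset.sum_le_sum fun i _ => ?_)
  calc star (X i * d i) * (X i * d i) = star (d i) * (star (X i) * X i) * d i := by
        simp only [star_mul, mul_assoc]
    _ ≤ ‖star (X i) * X i‖ • (star (d i) * d i) :=
        CStarAlgebra.star_left_conjugate_le_norm_smul (.star_mul_self _)
    _ ≤ t i • (star (d i) * d i) := by
        rw [CStarRing.norm_star_mul_self, ← sq]
        exact smul_le_smul_of_nonneg_right (hX i) (star_mul_self_nonneg _)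

theorem norm_sum_star_mul_mul_le (c X d : ι → A) {t : ι → ℝ} (hX : ∀ i, ‖X i‖ ^ 2 ≤ t i) :
    ‖∑ i, star (c i) * X i * d i‖ ≤
      √‖∑ i, star (c i) * c i‖ * √‖∑ i, t i • (star (d i) * d i)‖ := by
  simp only [mul_assoc]
  refine (norm_sum_star_mul_le_sqrt_mul_sqrt c fun i => X i * d i).trans ?_
  gcongr
  exact norm_sum_star_mul_self_mul_le X d hX

end ColumnNorms

section CesaroMean

theorem norm_pow_mul_sub_mul_pow_le {A : Type*} [SeminormedRing A] [NormOneClass A] {x y : A}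
    (hx : ‖x‖ ≤ 1) (hy : ‖y‖ ≤ 1) (a : A) (j : ℕ) :
    ‖x ^ j * a - a * y ^ j‖ ≤ j * ‖x * a - a * y‖ := by
  induction j with
  | zero => simp
  | succ j ih =>
    have hxj : ‖x ^ j‖ ≤ 1 := (norm_pow_le x j).trans (pow_le_one₀ (norm_nonneg _) hx)
    calc ‖x ^ (j + 1) * a - a * y ^ (j + 1)‖
        = ‖x ^ j * (x * a - a * y) + (x ^ j * a - a * y ^ j) * y‖ := by
          congr 1; simp only [pow_succ, mul_sub, sub_mul, mul_assoc]; abel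
      _ ≤ ‖x * a - a * y‖ + j * ‖x * a - a * y‖ :=
          norm_add_le_of_le (norm_mul_le_of_norm_le_one_left hxj _)
            ((norm_mul_le_of_norm_le_one_right hy _).trans ih)
      _ = (j + 1 : ℕ) * ‖x * a - a * y‖ := by push_cast; ring

/-- The Cesàro mean `(1/N) ∑_{j<N} x ^ j` of the powers of an element of a complex algebra. -/
noncomputable def cesaroMean {A : Type*} [Ring A] [Algebra ℂ A] (N : ℕ) (x : A) : A :=
  (N : ℂ)⁻¹ • ∑ j ∈ Finset.range N, x ^ j

theorem cesaroMean_mul_sub_one {A : Type*} [Ring A] [Algebra ℂ A] (N : ℕ) (x : A) :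
    cesaroMean N x * (x - 1) = (N : ℂ)⁻¹ • (x ^ N - 1) := by
  rw [cesaroMean, smul_mul_assoc, geom_sum_mul]

theorem commute_cesaroMean_right {A : Type*} [Ring A] [Algebra ℂ A] {x y : A} (h : Commute x y)
    (N : ℕ) : Commute x (cesaroMean N y) :=
  (Commute.sum_right _ _ _ fun j _ => h.pow_right j).smul_right _

theorem map_cesaroMean {A B F : Type*} [Ring A] [Algebra ℂ A] [Ring B] [Algebra ℂ B]
    [FunLike F A B] [AlgHomClass F ℂ A B] (f : F) (N : ℕ) (x : A) :
    f (cesaroMean N x) = cesaroMean N (f x) := by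
  simp only [cesaroMean, map_smul, map_sum, map_pow]

theorem norm_inv_smul_sum_range_le {E : Type*} [SeminormedAddCommGroup E] [NormedSpace ℂ E]
    (N : ℕ) (f : ℕ → E) {c : ℝ} (hc : 0 ≤ c) (h : ∀ j < N, ‖f j‖ ≤ c) :
    ‖(N : ℂ)⁻¹ • ∑ j ∈ Finset.range N, f j‖ ≤ c := by
  rcases N.eq_zero_or_pos with rfl | hN
  · simpa using hc
  rw [norm_smul, norm_inv, Complex.norm_natCast, inv_mul_le_iff₀ (by exact_mod_cast hN)]
  simpa using norm_sum_le_of_le _ fun j hj => h j (Finset.mem_range.mp hj)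

variable {A : Type*} [SeminormedRing A] [NormOneClass A] [NormedAlgebra ℂ A]

theorem norm_cesaroMean_le_one (N : ℕ) {x : A} (hx : ‖x‖ ≤ 1) : ‖cesaroMean N x‖ ≤ 1 :=
  norm_inv_smul_sum_range_le N _ zero_le_one fun j _ =>
    (norm_pow_le x j).trans (pow_le_one₀ (norm_nonneg _) hx)

theorem norm_cesaroMean_mul_sub_mul_cesaroMean_le (N : ℕ) {x y : A} (hx : ‖x‖ ≤ 1) (hy : ‖y‖ ≤ 1)
    (a : A) : ‖cesaroMean N x * a - a * cesaroMean N y‖ ≤ N * ‖x * a - a * y‖ := by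
  rw [cesaroMean, cesaroMean, smul_mul_assoc, mul_smul_comm, ← smul_sub, Finset.sum_mul,
    Finset.mul_sum, ← Finset.sum_sub_distrib]
  refine norm_inv_smul_sum_range_le N _ (by positivity) fun j hj =>
    (norm_pow_mul_sub_mul_pow_le hx hy a j).trans ?_
  gcongr

end CesaroMean

section RootsOfUnity

variable {N : ℕ} [NeZero N]

theorem coe_toCircle_pow_card (r : ZMod N) : (ZMod.toCircle r : ℂ) ^ N = 1 := by
  rw [← Circle.coe_pow, ← AddChar.map_nsmul_eq_pow, nsmul_eq_mul, CharP.cast_eq_zero, zero_mul,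
    AddChar.map_zero_eq_one, Circle.coe_one]

theorem sum_star_toCircle_pow_mul_toCircle_pow {i j : ℕ} (hi : i < N) (hj : j < N) :
    ∑ r : ZMod N, star (ZMod.toCircle r : ℂ) ^ i * (ZMod.toCircle r : ℂ) ^ j =
      if i = j then (N : ℂ) else 0 := by
  have term_eq (r : ZMod N) : star (ZMod.toCircle r : ℂ) ^ i * (ZMod.toCircle r : ℂ) ^ j =
      ZMod.stdAddChar (r * ((j : ZMod N) - (i : ZMod N))) := by
    rw [mul_sub, ← nsmul_eq_mul', ← nsmul_eq_mul', ZMod.stdAddChar_apply,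
      AddChar.map_sub_eq_div, AddChar.map_nsmul_eq_pow,
      AddChar.map_nsmul_eq_pow, Circle.coe_div, Circle.coe_pow, Circle.coe_pow, div_eq_mul_inv,
      ← inv_pow, ← Circle.coe_inv, Circle.coe_inv_eq_conj, mul_comm, starRingEnd_apply]
  have cast_eq_iff : (j : ZMod N) = i ↔ i = j := by
    rw [ZMod.natCast_eq_natCast_iff', Nat.mod_eq_of_lt hi, Nat.mod_eq_of_lt hj, eq_comm]
  simp only [term_eq, AddChar.sum_mulShift _ (ZMod.isPrimitive_stdAddChar N), ZMod.card,
    sub_eq_zero, cast_eq_iff, Nat.cast_ite, Nat.cast_zero]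

end RootsOfUnity

section FourierColumn

variable {A : Type*} [CStarAlgebra A] {N : ℕ} [NeZero N] {u : A}

/-- The column `(b_r)` of Cesàro means of the powers of `ζ_r u`, where `ζ_r` runs over the `N`-th
roots of unity. For unitary `u` the elements `b_r^* b_r` form a partition of unity (given by Fejér
kernels), the `r`-th of which is concentrated near `u = ζ_r⁻¹`. -/
noncomputable def fourierColumn (N : ℕ) [NeZero N] (u : A) (r : ZMod N) : A :=
  cesaroMean N ((ZMod.toCircle r : ℂ) • u)

theorem commute_fourierColumn (u : A) (r s : ZMod N) :
    Commute (fourierColumn N u r) (fourierColumn N u s) :=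
  have h : Commute u (fourierColumn N u s) :=
    commute_cesaroMean_right ((Commute.refl u).smul_right _) N
  (commute_cesaroMean_right (h.symm.smul_right _) N).symm

theorem commute_star_fourierColumn (hu : u ∈ unitary A) (r s : ZMod N) :
    Commute (star (fourierColumn N u r)) (fourierColumn N u s) := by
  have star_comm : Commute (star u) u :=
    (Unitary.star_mul_self_of_mem hu).trans (Unitary.mul_star_self_of_mem hu).symm
  have h : Commute (star (fourierColumn N u r)) u := by
    have h :=
      (commute_cesaroMean_right (N := N) (star_comm.smul_right (ZMod.toCircle r : ℂ))).star_star
    rw [star_star] at h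
    exact h.symm
  exact commute_cesaroMean_right (h.smul_right _) N

theorem map_fourierColumn {B : Type*} [CStarAlgebra B] (f : A →⋆ₐ[ℂ] B) (u : A) (r : ZMod N) :
    f (fourierColumn N u r) = fourierColumn N (f u) r := by
  simp only [fourierColumn, map_cesaroMean, map_smul]

theorem fourierColumn_toCircle_smul (u : A) (r s : ZMod N) :
    fourierColumn N ((ZMod.toCircle s : ℂ) • u) r = fourierColumn N u (r + s) := by
  rw [fourierColumn, fourierColumn, smul_smul, ← Circle.coe_mul, ← AddChar.map_add_eq_mul]

theorem sum_fourierColumn (u : A) : ∑ r : ZMod N, fourierColumn N u r = 1 := by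
  have coeff (j : ℕ) (hj : j ∈ Finset.range N) :
      ∑ r : ZMod N, ((ZMod.toCircle r : ℂ) • u) ^ j = if j = 0 then (N : ℂ) • 1 else 0 := by
    have h := sum_star_toCircle_pow_mul_toCircle_pow (NeZero.pos N) (Finset.mem_range.mp hj)
    simp only [pow_zero, one_mul, eq_comm (a := 0)] at h
    simp only [smul_pow, ← Finset.sum_smul, h]
    split_ifs with hj0 <;> simp [hj0]
  simp only [fourierColumn, cesaroMean]
  rw [← Finset.smul_sum, Finset.sum_comm, Finset.sum_congr rfl coeff, Finset.sum_ite_eq',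
    if_pos (Finset.mem_range.mpr (NeZero.pos N)), inv_smul_smul₀ (NeZero.ne _)]

theorem sum_star_fourierColumn_mul_self (hu : u ∈ unitary A) :
    ∑ r : ZMod N, star (fourierColumn N u r) * fourierColumn N u r = 1 := by
  have coeff (i : ℕ) (hi : i ∈ Finset.range N) (j : ℕ) (hj : j ∈ Finset.range N) :
      ∑ r : ZMod N, star ((ZMod.toCircle r : ℂ) • u) ^ i * ((ZMod.toCircle r : ℂ) • u) ^ j =
        if i = j then (N : ℂ) • 1 else 0 := by
    simp only [star_smul, smul_pow, smul_mul_smul_comm]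
    rw [← Finset.sum_smul, sum_star_toCircle_pow_mul_toCircle_pow (Finset.mem_range.mp hi)
      (Finset.mem_range.mp hj)]
    split_ifs with h
    · rw [← h, ← star_pow, Unitary.star_mul_self_of_mem (pow_mem hu i)]
    · rw [zero_smul]
  calc ∑ r : ZMod N, star (fourierColumn N u r) * fourierColumn N u r
      = ((N : ℂ)⁻¹ * (N : ℂ)⁻¹) • ∑ i ∈ Finset.range N, ∑ j ∈ Finset.range N, ∑ r : ZMod N,
          star ((ZMod.toCircle r : ℂ) • u) ^ i * ((ZMod.toCircle r : ℂ) • u) ^ j := by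
        simp only [fourierColumn, cesaroMean, star_smul _ (Finset.sum _ _), star_sum, star_pow,
          smul_mul_smul_comm, Finset.sum_mul_sum, star_inv₀, star_natCast]
        rw [← Finset.smul_sum, Finset.sum_comm]
        exact congrArg _ (Finset.sum_congr rfl fun i _ => Finset.sum_comm)
    _ = ((N : ℂ)⁻¹ * (N : ℂ)⁻¹) • ∑ i ∈ Finset.range N, ∑ j ∈ Finset.range N,
          if i = j then (N : ℂ) • (1 : A) else 0 := by
        congr 1
        exact Finset.sum_congr rfl fun i hi => Finset.sum_congr rfl (coeff i hi)
    _ = 1 := by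
        have hN : (N : ℂ) ≠ 0 := NeZero.ne _
        simp only [Finset.sum_ite_eq, ← Finset.sum_filter, Finset.filter_true_of_mem fun _ => id,
          Finset.sum_const, Finset.card_range, ← Nat.cast_smul_eq_nsmul ℂ, smul_smul]
        rw [mul_assoc, inv_mul_cancel_left₀ hN, inv_mul_cancel₀ hN, one_smul]

/-- The mean `∑_r ζ_r b_r^* b_r` of the `N`-th roots of unity with respect to the partition of unity
`b_r^* b_r`; it approximates `u^*`. -/
noncomputable def fejerMean (N : ℕ) [NeZero N] (u : A) : A :=
  ∑ r : ZMod N, (ZMod.toCircle r : ℂ) • (star (fourierColumn N u r) * fourierColumn N u r)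

theorem fejerMean_mul (u : A) :
    fejerMean N u * u =
      ∑ r : ZMod N, star (fourierColumn N u r) * fourierColumn N u r +
        (N : ℂ)⁻¹ • (u ^ N - 1) := by
  have shift (r : ZMod N) : fourierColumn N u r * ((ZMod.toCircle r : ℂ) • u) =
      fourierColumn N u r + (N : ℂ)⁻¹ • (u ^ N - 1) := by
    have h := cesaroMean_mul_sub_one N ((ZMod.toCircle r : ℂ) • u)
    rw [smul_pow, coe_toCircle_pow_card, one_smul, mul_sub, mul_one, sub_eq_iff_eq_add'] at h
    exact h
  calc _ = ∑ r : ZMod N,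
        star (fourierColumn N u r) * (fourierColumn N u r * ((ZMod.toCircle r : ℂ) • u)) := by
        simp only [fejerMean, Finset.sum_mul, smul_mul_assoc, mul_smul_comm, mul_assoc]
    _ = _ := by
        simp only [shift, mul_add, Finset.sum_add_distrib, ← Finset.sum_mul, ← star_sum,
          sum_fourierColumn, star_one, one_mul]

variable [Nontrivial A]

theorem norm_toCircle_smul_le_one (hu : u ∈ unitary A) (ζ : Circle) : ‖(ζ : ℂ) • u‖ ≤ 1 := by
  rw [norm_smul, Circle.norm_coe, CStarRing.norm_of_mem_unitary hu, one_mul]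

theorem norm_fourierColumn_le_one (hu : u ∈ unitary A) (r : ZMod N) : ‖fourierColumn N u r‖ ≤ 1 :=
  norm_cesaroMean_le_one N (norm_toCircle_smul_le_one hu _)

theorem norm_fourierColumn_mul_sub_mul_le {v : A} (hu : u ∈ unitary A) (hv : v ∈ unitary A)
    (r : ZMod N) (a : A) :
    ‖fourierColumn N u r * a - a * fourierColumn N v r‖ ≤ N * ‖u * a - a * v‖ := by
  refine (norm_cesaroMean_mul_sub_mul_cesaroMean_le N (norm_toCircle_smul_le_one hu _)
    (norm_toCircle_smul_le_one hv _) a).trans_eq ?_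
  rw [smul_mul_assoc, mul_smul_comm, ← smul_sub, norm_smul, Circle.norm_coe, one_mul]

theorem norm_star_fourierColumn_mul_sub_mul_le {v : A} (hu : u ∈ unitary A) (hv : v ∈ unitary A)
    (r : ZMod N) (a : A) :
    ‖star (fourierColumn N u r) * a - a * star (fourierColumn N v r)‖ ≤ N * ‖u * a - a * v‖ := by
  have h : v * star a - star a * u = v * star (u * a - a * v) * u := by
    simp only [star_sub, star_mul, mul_sub, sub_mul, mul_assoc, Unitary.star_mul_self_of_mem hu,
      mul_one]
    rw [← mul_assoc v (star v), Unitary.mul_star_self_of_mem hv, one_mul]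
  calc ‖star (fourierColumn N u r) * a - a * star (fourierColumn N v r)‖
      = ‖fourierColumn N v r * star a - star a * fourierColumn N u r‖ := by
        rw [← norm_star, star_sub, star_mul, star_mul, star_star, star_star, norm_sub_rev]
    _ ≤ N * ‖v * star (u * a - a * v) * u‖ := h ▸ norm_fourierColumn_mul_sub_mul_le hv hu r _
    _ = N * ‖u * a - a * v‖ := by
        rw [CStarRing.norm_mul_mem_unitary _ hu, CStarRing.norm_mem_unitary_mul _ hv, norm_star]

theorem norm_fejerMean_sub_star_le (hu : u ∈ unitary A) :
    ‖fejerMean N u - star u‖ ≤ 2 / N := by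
  have h := fejerMean_mul (N := N) u
  rw [sum_star_fourierColumn_mul_self hu, ← sub_eq_iff_eq_add',
    ← Unitary.star_mul_self_of_mem hu, ← sub_mul] at h
  rw [← CStarRing.norm_mul_mem_unitary _ hu, h, norm_smul, norm_inv, Complex.norm_natCast,
    div_eq_inv_mul]
  gcongr
  refine (norm_sub_le _ _).trans_eq ?_
  rw [CStarRing.norm_of_mem_unitary (pow_mem hu N), Unitary.star_mul_self_of_mem hu, norm_one]
  norm_num

end FourierColumn

section ProjectionStability

open Filter Topology Polynomial

variable {A ι : Type*} [CStarAlgebra A]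

/-- The continuous function which is `1` on `[c - 1/3, c + 1/3]`, vanishes at distance at least
`2/3` from `c` and is affine in between. -/
noncomputable def bump (c x : ℝ) : ℝ := max 0 (min 1 (2 - 3 * |x - c|))

theorem continuous_bump (c : ℝ) : Continuous (bump c) := by
  unfold bump; fun_prop

theorem injective_of_pairwise_one_le_abs_sub {x : ι → ℝ}
    (hsep : Pairwise fun k l => 1 ≤ |x k - x l|) : Function.Injective x := by
  intro k l hkl
  by_contra hne
  have : 1 ≤ |x k - x l| := hsep hne
  rw [hkl, sub_self, abs_zero] at this
  exact (zero_lt_one.trans_le this).false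

theorem bump_eq_ite [DecidableEq ι] {x : ι → ℝ} (hsep : Pairwise fun k l => 1 ≤ |x k - x l|)
    {l : ι} {y : ℝ} (hy : |y - x l| ≤ 1 / 3) (k : ι) : bump (x k) y = if k = l then 1 else 0 := by
  split_ifs with hkl
  · rw [bump, hkl, min_eq_left (by linarith), max_eq_right zero_le_one]
  · have far := (hsep hkl).trans (abs_sub_le (x k) y (x l))
    rw [abs_sub_comm (x k)] at far
    exact max_eq_left ((min_le_right _ _).trans (by linarith))

variable [Fintype ι]

theorem tendsto_aeval_sum_smul_sub {J : Type*} {F : Filter J} {p : J → ι → A} [DecidableEq ι]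
    (hsum : ∀ j, ∑ k, p j k = 1) (hnorm : ∀ j k, ‖p j k‖ ≤ 1)
    (hmul : ∀ k l, Tendsto (fun j => p j k * p j l - if k = l then p j k else 0) F (𝓝 0))
    (x : ι → ℝ) (q : ℝ[X]) :
    Tendsto (fun j => aeval (∑ k, x k • p j k) q - ∑ k, q.eval (x k) • p j k) F (𝓝 0) := by
  induction q using Polynomial.induction_on with
  | C a =>
    simp only [aeval_C, eval_C, ← Finset.smul_sum, hsum, Algebra.algebraMap_eq_smul_one, sub_self,
      tendsto_const_nhds]
  | add q r hq hr =>
    refine (add_zero (0 : A) ▸ hq.add hr).congr fun j => ?_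
    simp only [map_add, eval_add, add_smul, Finset.sum_add_distrib]
    abel
  | monomial n a hq =>
    set q : ℝ[X] := C a * X ^ n
    have bounded : IsBoundedUnder (· ≤ ·) F (norm ∘ fun j => ∑ k, x k • p j k) := by
      refine isBoundedUnder_of ⟨∑ k, |x k|, fun j => norm_sum_le_of_le _ fun k _ => ?_⟩
      rw [norm_smul, Real.norm_eq_abs]
      exact mul_le_of_le_one_right (abs_nonneg _) (hnorm j k)
    have cross : Tendsto (fun j => ∑ k, ∑ l, (x k * q.eval (x l)) •
        (p j k * p j l - if k = l then p j k else 0)) F (𝓝 0) := by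
      simpa using tendsto_finsetSum Finset.univ fun k _ => tendsto_finsetSum Finset.univ
        fun l _ => (hmul k l).const_smul (x k * q.eval (x l))
    refine (add_zero (0 : A) ▸ (isBoundedUnder_le_mul_tendsto_zero bounded hq).add cross).congr
      fun j => ?_
    have succ_eq : C a * X ^ (n + 1) = X * q := by simp only [q]; ring
    simp only [succ_eq, map_mul, aeval_X, mul_sub, Finset.sum_mul_sum, smul_sub,
      Finset.sum_sub_distrib, eval_mul, eval_X, smul_mul_smul_comm, smul_ite, smul_zero,
      Finset.sum_ite_eq, Finset.mem_univ, if_true, sub_add_sub_cancel]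

theorem eventually_spectrum_subset_iUnion {J : Type*} {F : Filter J} {h : J → A} {x : ι → ℝ}
    (hx : Tendsto (fun j => aeval (h j) (Lagrange.nodal Finset.univ x)) F (𝓝 0))
    {U : ι → Set ℝ} (hU : ∀ l, U l ∈ 𝓝 (x l)) : ∀ᶠ j in F, spectrum ℝ (h j) ⊆ ⋃ l, U l := by
  nontriviality A
  have ball_subset : ∀ᶠ η in 𝓝[>] (0 : ℝ), ∀ l, Metric.ball (x l) η ⊆ U l := by
    refine eventually_all.mpr fun l => ?_
    obtain ⟨r, hr, hball⟩ := Metric.mem_nhds_iff.mp (hU l)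
    filter_upwards [Ioo_mem_nhdsGT hr] with η hη using (Metric.ball_subset_ball hη.2.le).trans hball
  obtain ⟨η, hball, hη : 0 < η⟩ := (ball_subset.and self_mem_nhdsWithin).exists
  filter_upwards [(tendsto_zero_iff_norm_tendsto_zero.mp hx).eventually_lt_const
    (pow_pos hη (Fintype.card ι))] with j hj y hy
  by_contra hyU
  have far (l : ι) : η ≤ ‖y - x l‖ :=
    not_lt.mp fun hlt => hyU (Set.mem_iUnion_of_mem l (hball l (mem_ball_iff_norm.mpr hlt)))
  have eval_mem : eval y (Lagrange.nodal Finset.univ x) ∈ _ :=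
    spectrum.subset_polynomial_aeval (h j) _ ⟨y, hy, rfl⟩
  refine (((spectrum.norm_le_norm_of_mem eval_mem).trans_lt hj).trans_le ?_).false
  rw [Lagrange.eval_nodal, norm_prod, Fintype.card, ← Finset.prod_const]
  exact Finset.prod_le_prod (fun _ _ => hη.le) fun l _ => far l

theorem completeOrthogonalIdempotents_cfc [DecidableEq ι] {f : ι → ℝ → ℝ}
    (hf : ∀ k, Continuous (f k)) {h : A} (hh : IsSelfAdjoint h)
    (hspec : ∀ y ∈ spectrum ℝ h, ∃ l, ∀ k, f k y = if k = l then 1 else 0) :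
    CompleteOrthogonalIdempotents fun k => cfc (f k) h where
  idem k := by
    rw [IsIdempotentElem, ← cfc_mul _ _ _ (hf k).continuousOn (hf k).continuousOn]
    refine cfc_congr fun y hy => ?_
    obtain ⟨l, hl⟩ := hspec y hy
    simp [hl]
  ortho k k' hk := by
    dsimp only
    rw [← cfc_mul _ _ _ (hf k).continuousOn (hf k').continuousOn, ← cfc_const_zero ℝ h]
    refine cfc_congr fun y hy => ?_
    obtain ⟨l, hl⟩ := hspec y hy
    simp only [hl, ite_zero_mul_ite_zero, mul_one, ite_eq_right_iff, one_ne_zero, imp_false]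
    exact fun hkl => hk (hkl.1.trans hkl.2.symm)
  complete := by
    rw [← cfc_sum_univ _ _ (fun k => (hf k).continuousOn), ← cfc_const_one ℝ h]
    refine cfc_congr fun y hy => ?_
    obtain ⟨l, hl⟩ := hspec y hy
    simp [hl]

variable [DecidableEq ι]

theorem eval_basis_eq_ite {x : ι → ℝ} (hx : Function.Injective x) (k l : ι) :
    (Lagrange.basis Finset.univ x k).eval (x l) = if k = l then 1 else 0 := by
  split_ifs with hkl
  · exact hkl ▸ Lagrange.eval_basis_self hx.injOn (Finset.mem_univ k)
  · exact Lagrange.eval_basis_of_ne hkl (Finset.mem_univ l)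

theorem eventually_near_node {x : ι → ℝ} (hsep : Pairwise fun k l => 1 ≤ |x k - x l|)
    {ε : ℝ} (hε : 0 < ε) (l : ι) : ∀ᶠ y in 𝓝 (x l), |y - x l| ≤ 1 / 3 ∧
      ∀ k, ‖bump (x k) y - (Lagrange.basis Finset.univ x k).eval y‖ ≤ ε := by
  have dist_tendsto : Tendsto (fun y => |y - x l|) (𝓝 (x l)) (𝓝 0) := by
    simpa using (continuous_sub_right (x l)).abs.tendsto (x l)
  refine (dist_tendsto.eventually_le_const (by norm_num)).and (eventually_all.mpr fun k => ?_)
  have diff_continuous : Continuous fun y => ‖bump (x k) y - (Lagrange.basis .univ x k).eval y‖ :=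
    ((continuous_bump (x k)).sub (Lagrange.basis Finset.univ x k).continuous).norm
  refine (diff_continuous.tendsto' (x l) 0 ?_).eventually_le_const hε
  rw [bump_eq_ite hsep (by simp : |x l - x l| ≤ 1 / 3),
    eval_basis_eq_ite (injective_of_pairwise_one_le_abs_sub hsep),
    sub_self, norm_zero]

/-- If the `p_k` were orthogonal projections, then `h = ∑ x_k p_k` would have spectrum `{x_k}` and
`p_k` would be the spectral projection of `h` at `x_k`; in general the spectrum of `h` is near the
`x_k`, and the `p_k` are replaced by the spectral projections of `h` around `x_k`. -/
theorem eventually_exists_projections_near {J : Type*} {F : Filter J} {p : J → ι → A}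
    (hsa : ∀ j k, IsSelfAdjoint (p j k)) (hsum : ∀ j, ∑ k, p j k = 1) (hnorm : ∀ j k, ‖p j k‖ ≤ 1)
    (hmul : ∀ k l, Tendsto (fun j => p j k * p j l - if k = l then p j k else 0) F (𝓝 0))
    {ε : ℝ} (hε : 0 < ε) :
    ∀ᶠ j in F, ∃ e : ι → A, (∀ k, IsSelfAdjoint (e k)) ∧ CompleteOrthogonalIdempotents e ∧
      ∀ k, ‖e k - p j k‖ < ε := by
  obtain ⟨x, hsep⟩ : ∃ x : ι → ℝ, Pairwise fun k l => 1 ≤ |x k - x l| :=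
    ⟨fun k => ((Fintype.equivFin ι k : ℤ) : ℝ), fun k l hkl => by
      simpa using Int.cast_le (R := ℝ).mpr <| Int.one_le_abs <| sub_ne_zero.mpr fun h =>
        hkl ((Fintype.equivFin ι).injective (Fin.ext (Int.natCast_inj.mp h)))⟩
  have hx := injective_of_pairwise_one_le_abs_sub hsep
  have nodal_tendsto := tendsto_aeval_sum_smul_sub hsum hnorm hmul x (Lagrange.nodal .univ x)
  simp only [Lagrange.eval_nodal_at_node (Finset.mem_univ _), zero_smul, Finset.sum_const_zero,
    sub_zero] at nodal_tendsto
  have basis_tendsto (k : ι) := tendsto_aeval_sum_smul_sub hsum hnorm hmul x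
    (Lagrange.basis .univ x k)
  simp only [eval_basis_eq_ite hx, ite_smul, one_smul, zero_smul, Finset.sum_ite_eq,
    Finset.mem_univ, if_true] at basis_tendsto
  filter_upwards [eventually_spectrum_subset_iUnion nodal_tendsto
    (eventually_near_node hsep (half_pos hε)), eventually_all.mpr fun k =>
    (basis_tendsto k).norm.eventually_lt_const (norm_zero.trans_lt (half_pos hε))]
    with j hspec hbasis
  have hh : IsSelfAdjoint (∑ k, x k • p j k) :=
    isSelfAdjoint_sum _ fun k _ => (IsSelfAdjoint.all (x k)).smul (hsa j k)
  refine ⟨fun k => cfc (bump (x k)) (∑ k, x k • p j k), fun k => cfc_predicate _ _,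
    completeOrthogonalIdempotents_cfc (fun k => continuous_bump _) hh fun y hy => ?_, fun k => ?_⟩
  · obtain ⟨l, hyl, -⟩ := Set.mem_iUnion.mp (hspec hy)
    exact ⟨l, bump_eq_ite hsep hyl⟩
  · refine (norm_sub_le_norm_sub_add_norm_sub _ _ _).trans_lt
      (add_lt_add_of_le_of_lt ?_ (hbasis k) |>.trans_eq (add_halves ε))
    rw [← cfc_polynomial (Lagrange.basis .univ x k) _ hh,
      ← cfc_sub _ _ _ (continuous_bump _).continuousOn (Polynomial.continuous _).continuousOn]
    refine norm_cfc_le (half_pos hε).le fun y hy => ?_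
    obtain ⟨l, -, hyl⟩ := Set.mem_iUnion.mp (hspec hy)
    exact hyl k

theorem exists_projections_near {ε : ℝ} (hε : 0 < ε) :
    ∃ δ > 0, ∀ p : ι → A, (∀ k, IsSelfAdjoint (p k)) → ∑ k, p k = 1 → (∀ k, ‖p k‖ ≤ 1) →
      (∀ k l, ‖p k * p l - if k = l then p k else 0‖ < δ) →
      ∃ e : ι → A, (∀ k, IsSelfAdjoint (e k)) ∧ CompleteOrthogonalIdempotents e ∧
        ∀ k, ‖e k - p k‖ < ε := by
  let P := {p : ι → A // (∀ k, IsSelfAdjoint (p k)) ∧ ∑ k, p k = 1 ∧ ∀ k, ‖p k‖ ≤ 1}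
  let defect (p : P) (kl : ι × ι) : A := p.1 kl.1 * p.1 kl.2 - if kl.1 = kl.2 then p.1 kl.1 else 0
  have defect_tendsto (k l : ι) : Tendsto (fun p => defect p (k, l)) (comap defect (𝓝 0)) (𝓝 0) :=
    tendsto_pi_nhds.mp tendsto_comap (k, l)
  have near := eventually_exists_projections_near (p := fun p : P => p.1) (fun p => p.2.1)
    (fun p => p.2.2.1) (fun p => p.2.2.2) defect_tendsto hε
  obtain ⟨δ, hδ, hnear⟩ := (Metric.nhds_basis_ball.comap defect).eventually_iff.mp near
  refine ⟨δ, hδ, fun p hsa hsum hnorm hmul => hnear (x := ⟨p, hsa, hsum, hnorm⟩) ?_⟩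
  exact mem_ball_zero_iff.mpr ((pi_norm_lt_iff hδ).mpr fun kl => hmul kl.1 kl.2)

end ProjectionStability

section FejerVariance

variable {A : Type*} [CStarAlgebra A] {N : ℕ} [NeZero N] {u : A}

theorem star_fourierColumn_mul_fourierColumn_mul_self (hu : u ∈ unitary A) (r s : ZMod N) :
    star (fourierColumn N u r * fourierColumn N u s) * (fourierColumn N u r * fourierColumn N u s) =
      star (fourierColumn N u s) * fourierColumn N u s *
        (star (fourierColumn N u r) * fourierColumn N u r) := by
  have h := ((commute_star_fourierColumn hu r s).mul_left (commute_fourierColumn u r s)).eq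
  rw [star_mul, mul_assoc, ← mul_assoc (star (fourierColumn N u r)), h]
  simp only [mul_assoc]

theorem sum_norm_toCircle_sub_sq_smul (hu : u ∈ unitary A) :
    ∑ p : ZMod N × ZMod N, ‖(ZMod.toCircle p.1 : ℂ) - ZMod.toCircle p.2‖ ^ 2 •
        (star (fourierColumn N u p.2 * fourierColumn N u p.1) *
          (fourierColumn N u p.2 * fourierColumn N u p.1)) =
      2 - (fejerMean N u * star (fejerMean N u) + star (fejerMean N u) * fejerMean N u) := by
  have coeff (ζ ξ : Circle) : ((‖(ζ : ℂ) - ξ‖ ^ 2 : ℝ) : ℂ) =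
      2 - ((ζ : ℂ) * star (ξ : ℂ) + star (ζ : ℂ) * ξ) := by
    have mul_star_self (ω : Circle) : (ω : ℂ) * star (ω : ℂ) = 1 := by
      rw [← starRingEnd_apply, Complex.mul_conj, Circle.normSq_coe, Complex.ofReal_one]
    rw [← Complex.normSq_eq_norm_sq, ← Complex.mul_conj, starRingEnd_apply, star_sub]
    linear_combination mul_star_self ζ + mul_star_self ξ
  simp only [star_fourierColumn_mul_fourierColumn_mul_self hu]
  simp only [fejerMean, ← Complex.coe_smul, coeff, sub_smul,
    add_smul, Finset.sum_sub_distrib, Finset.sum_add_distrib, star_sum, star_smul, star_mul,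
    star_star, Fintype.sum_prod_type, Finset.sum_mul_sum, smul_mul_smul_comm, ← Finset.smul_sum]
  congr 1
  rw [← Finset.sum_mul_sum, sum_star_fourierColumn_mul_self hu, mul_one, two_smul,
    one_add_one_eq_two]

variable [Nontrivial A]

theorem norm_fejerMean_le_one (hu : u ∈ unitary A) : ‖fejerMean N u‖ ≤ 1 := by
  have h := norm_sum_star_mul_mul_le (fourierColumn N u)
    (fun r => algebraMap ℂ A (ZMod.toCircle r)) (fourierColumn N u) (t := fun _ => 1)
    fun r => by rw [norm_algebraMap', Circle.norm_coe, one_pow]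
  simpa only [fejerMean, ← Algebra.commutes, ← Algebra.smul_def, smul_mul_assoc, one_smul,
    sum_star_fourierColumn_mul_self hu, norm_one, Real.sqrt_one, mul_one] using h

theorem norm_sum_norm_toCircle_sub_sq_smul_le (hu : u ∈ unitary A) :
    ‖∑ p : ZMod N × ZMod N, ‖(ZMod.toCircle p.1 : ℂ) - ZMod.toCircle p.2‖ ^ 2 •
      (star (fourierColumn N u p.2 * fourierColumn N u p.1) *
        (fourierColumn N u p.2 * fourierColumn N u p.1))‖ ≤ 8 / N := by
  have mean_near := norm_fejerMean_sub_star_le (N := N) hu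
  have norm_mean_le := norm_fejerMean_le_one (N := N) hu
  have norm_u_le : ‖u‖ ≤ 1 := (CStarRing.norm_of_mem_unitary hu).le
  rw [sum_norm_toCircle_sub_sq_smul hu]
  generalize fejerMean N u = m at *
  have star_mean_near : ‖star m - u‖ ≤ 2 / N := by
    rwa [← norm_star, star_sub, star_star]
  have decomp : 2 - (m * star m + star m * m) = -((m - star u) * star m + star u * (star m - u) +
      (star m * (m - star u) + (star m - u) * star u)) := by
    rw [← one_add_one_eq_two]
    nth_rewrite 1 [← Unitary.star_mul_self_of_mem hu]
    rw [← Unitary.mul_star_self_of_mem hu]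
    simp only [mul_sub, sub_mul]
    abel
  rw [decomp, norm_neg]
  calc _ ≤ (2 / N + 2 / N : ℝ) + (2 / N + 2 / N) := by
        refine norm_add_le_of_le (norm_add_le_of_le ?_ ?_) (norm_add_le_of_le ?_ ?_)
        · exact (norm_mul_le_of_norm_le_one_right (by rwa [norm_star]) _).trans mean_near
        · exact (norm_mul_le_of_norm_le_one_left (by rwa [norm_star]) _).trans star_mean_near
        · exact (norm_mul_le_of_norm_le_one_left (by rwa [norm_star]) _).trans mean_near
        · exact (norm_mul_le_of_norm_le_one_right (by rwa [norm_star]) _).trans star_mean_near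
    _ = 8 / N := by ring

end FejerVariance

section Compress

variable {A : Type*} [CStarAlgebra A] {N : ℕ} [NeZero N] {u : A}

/-- The compression `∑_r b_r^* X(ζ_r) b_r` of an `A`-valued function on the circle along the column
`fourierColumn N u`: a discretized functional calculus, which for large `N` evaluates `X` at
`u⁻¹` up to the failure of `u` to commute with the values of `X`. -/
noncomputable def compress (N : ℕ) [NeZero N] (u : A) (X : Circle → A) : A :=
  ∑ r : ZMod N, star (fourierColumn N u r) * X (ZMod.toCircle r) * fourierColumn N u r

theorem compress_one (hu : u ∈ unitary A) : compress N u 1 = 1 := by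
  simp only [compress, Pi.one_apply, mul_one, sum_star_fourierColumn_mul_self hu]

theorem compress_zero (u : A) : compress N u 0 = 0 := by
  simp only [compress, Pi.zero_apply, mul_zero, zero_mul, Finset.sum_const_zero]

theorem sum_compress {ι : Type*} [Fintype ι] (u : A) (X : ι → Circle → A) :
    ∑ i, compress N u (X i) = compress N u (∑ i, X i) := by
  simp only [compress, Finset.sum_apply, Finset.mul_sum, Finset.sum_mul]
  exact Finset.sum_comm

theorem isSelfAdjoint_compress (u : A) {X : Circle → A} (hX : ∀ ζ, IsSelfAdjoint (X ζ)) :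
    IsSelfAdjoint (compress N u X) :=
  isSelfAdjoint_sum _ fun _ _ => (hX _).conjugate' _

theorem map_compress {B : Type*} [CStarAlgebra B] (f : A →⋆ₐ[ℂ] B) (u : A) (X : Circle → A) :
    f (compress N u X) = compress N (f u) (f ∘ X) := by
  simp only [compress, map_sum, map_mul, map_star, map_fourierColumn, Function.comp_apply]

theorem compress_toCircle_smul (u : A) (X : Circle → A) (s : ZMod N) :
    compress N ((ZMod.toCircle s : ℂ) • u) X =
      compress N u fun ζ => X (ζ * (ZMod.toCircle s)⁻¹) := by
  simp only [compress, fourierColumn_toCircle_smul]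
  refine Fintype.sum_equiv (Equiv.addRight s) _ _ fun r => ?_
  rw [Equiv.coe_addRight, AddChar.map_add_eq_mul, mul_inv_cancel_right]

theorem compress_mul_compress_sub (hu : u ∈ unitary A) (X Y : Circle → A) :
    compress N u X * compress N u Y - compress N u (X * Y) =
      ∑ p : ZMod N × ZMod N, (star (fourierColumn N u p.1) * (X (ZMod.toCircle p.1) *
          (star (fourierColumn N u p.2) * ((fourierColumn N u p.1 * Y (ZMod.toCircle p.2) -
            Y (ZMod.toCircle p.2) * fourierColumn N u p.1) * fourierColumn N u p.2))) +
        star (fourierColumn N u p.1) * (X (ZMod.toCircle p.1) *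
          ((star (fourierColumn N u p.2) * Y (ZMod.toCircle p.1) -
            Y (ZMod.toCircle p.1) * star (fourierColumn N u p.2)) * fourierColumn N u p.2 *
              fourierColumn N u p.1))) +
      ∑ p : ZMod N × ZMod N,
        star (fourierColumn N u p.2 * star (X (ZMod.toCircle p.1)) * fourierColumn N u p.1) *
          (Y (ZMod.toCircle p.2) - Y (ZMod.toCircle p.1)) *
          (fourierColumn N u p.2 * fourierColumn N u p.1) := by
  let b := fourierColumn N u
  let x (r : ZMod N) := X (ZMod.toCircle r)
  let y (r : ZMod N) := Y (ZMod.toCircle r)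
  have expand_prod : compress N u X * compress N u Y = ∑ p : ZMod N × ZMod N,
      star (b p.1) * (x p.1 * (star (b p.2) * (b p.1 * (y p.2 * b p.2)))) := by
    rw [compress, compress, Finset.sum_mul_sum, Fintype.sum_prod_type]
    refine Finset.sum_congr rfl fun r _ => Finset.sum_congr rfl fun s _ => ?_
    rw [← mul_assoc (star (b s)) (b r), (commute_star_fourierColumn hu s r).eq]
    simp only [b, x, y, mul_assoc]
  have expand_compress : compress N u (X * Y) = ∑ p : ZMod N × ZMod N,
      star (b p.1) * (x p.1 * (y p.1 * (star (b p.2) * (b p.2 * b p.1)))) := by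
    simp only [Fintype.sum_prod_type, ← mul_assoc (star (b _)) (b _), ← Finset.mul_sum,
      ← Finset.sum_mul, b, x, y, sum_star_fourierColumn_mul_self hu, one_mul]
    simp only [compress, Pi.mul_apply, mul_assoc]
  rw [expand_prod, expand_compress, ← Finset.sum_sub_distrib, ← Finset.sum_add_distrib]
  refine Finset.sum_congr rfl fun p _ => ?_
  simp only [star_mul, star_star, mul_sub, sub_mul, mul_assoc,
    (commute_fourierColumn u p.2 p.1).eq, b, x, y]
  abel

variable [Nontrivial A]

theorem norm_compress_le (hu : u ∈ unitary A) {X : Circle → A} (hX : ∀ ζ, ‖X ζ‖ ≤ 1) :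
    ‖compress N u X‖ ≤ 1 := by
  have h := norm_sum_star_mul_mul_le (fourierColumn N u) (fun r => X (ZMod.toCircle r))
    (fourierColumn N u) (t := fun _ => 1) fun r => pow_le_one₀ (norm_nonneg _) (hX _)
  simpa only [compress, one_smul, sum_star_fourierColumn_mul_self hu, norm_one, Real.sqrt_one,
    mul_one] using h

theorem norm_compress_mul_sub_mul_compress_le {v : A} (hu : u ∈ unitary A) (hv : v ∈ unitary A)
    {X : Circle → A} (hX : ∀ ζ, ‖X ζ‖ ≤ 1) (a : A) {c : ℝ}
    (hXa : ∀ ζ, ‖X ζ * a - a * X ζ‖ ≤ c) :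
    ‖compress N u X * a - a * compress N v X‖ ≤ 2 * N ^ 2 * ‖u * a - a * v‖ + c := by
  have hc : 0 ≤ c := (norm_nonneg _).trans (hXa 1)
  have norm_star_le (r : ZMod N) : ‖star (fourierColumn N u r)‖ ≤ 1 :=
    (norm_star _).trans_le (norm_fourierColumn_le_one hu r)
  have decomp : compress N u X * a - a * compress N v X =
      ∑ r : ZMod N, star (fourierColumn N u r) * X (ZMod.toCircle r) *
        (fourierColumn N u r * a - a * fourierColumn N v r) +
      ∑ r : ZMod N, (star (fourierColumn N u r) * a - a * star (fourierColumn N v r)) *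
        (X (ZMod.toCircle r) * fourierColumn N v r) +
      ∑ r : ZMod N, star (fourierColumn N u r) *
        (X (ZMod.toCircle r) * a - a * X (ZMod.toCircle r)) * fourierColumn N v r := by
    simp only [compress, Finset.sum_mul, Finset.mul_sum, ← Finset.sum_sub_distrib,
      ← Finset.sum_add_distrib]
    refine Finset.sum_congr rfl fun r _ => ?_
    simp only [mul_sub, sub_mul, mul_assoc]
    abel
  rw [decomp]
  calc _ ≤ ∑ _r : ZMod N, N * ‖u * a - a * v‖ + ∑ _r : ZMod N, N * ‖u * a - a * v‖ + c := by
        refine norm_add₃_le.trans (add_le_add_three (norm_sum_le_of_le _ fun r _ => ?_)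
          (norm_sum_le_of_le _ fun r _ => ?_) ?_)
        · rw [mul_assoc]
          exact (norm_mul_le_of_norm_le_one_left (norm_star_le r) _).trans <|
            (norm_mul_le_of_norm_le_one_left (hX _) _).trans <|
            norm_fourierColumn_mul_sub_mul_le hu hv r a
        · rw [← mul_assoc]
          exact (norm_mul_le_of_norm_le_one_right (norm_fourierColumn_le_one hv r) _).trans <|
            (norm_mul_le_of_norm_le_one_right (hX _) _).trans <|
            norm_star_fourierColumn_mul_sub_mul_le hu hv r a
        · simpa only [← Finset.smul_sum, sum_star_fourierColumn_mul_self hu,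
            sum_star_fourierColumn_mul_self hv, norm_one, Real.sqrt_one, one_mul, norm_smul,
            mul_one, Real.norm_eq_abs, abs_sq, Real.sqrt_sq hc] using
            norm_sum_star_mul_mul_le (fourierColumn N u)
              (fun r => X (ZMod.toCircle r) * a - a * X (ZMod.toCircle r)) (fourierColumn N v)
              (t := fun _ => c ^ 2) fun r => pow_le_pow_left₀ (norm_nonneg _) (hXa _) 2
    _ = 2 * N ^ 2 * ‖u * a - a * v‖ + c := by
        rw [Finset.sum_const, Finset.card_univ, ZMod.card, nsmul_eq_mul]
        ring

theorem norm_sum_mul_sub_mul_le (hu : u ∈ unitary A) {X Y : Circle → A} (hX : ∀ ζ, ‖X ζ‖ ≤ 1)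
    {δ C : ℝ} (hδ : 0 ≤ δ) (hC : 0 ≤ C)
    (hY : ∀ ζ ξ : Circle, ‖Y ξ - Y ζ‖ ^ 2 ≤ δ + C * ‖(ζ : ℂ) - ξ‖ ^ 2) :
    ‖∑ p : ZMod N × ZMod N,
      star (fourierColumn N u p.2 * star (X (ZMod.toCircle p.1)) * fourierColumn N u p.1) *
        (Y (ZMod.toCircle p.2) - Y (ZMod.toCircle p.1)) *
        (fourierColumn N u p.2 * fourierColumn N u p.1)‖ ≤ √(δ + C * (8 / N)) := by
  have norm_left_le : ‖∑ p : ZMod N × ZMod N,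
      star (fourierColumn N u p.2 * star (X (ZMod.toCircle p.1)) * fourierColumn N u p.1) *
        (fourierColumn N u p.2 * star (X (ZMod.toCircle p.1)) * fourierColumn N u p.1)‖ ≤ 1 := by
    have h : compress N u (fun ζ => X ζ * star (X ζ)) = ∑ p : ZMod N × ZMod N,
        star (fourierColumn N u p.2 * star (X (ZMod.toCircle p.1)) * fourierColumn N u p.1) *
        (fourierColumn N u p.2 * star (X (ZMod.toCircle p.1)) * fourierColumn N u p.1) := by
      rw [Fintype.sum_prod_type, compress]
      refine Finset.sum_congr rfl fun r _ => ?_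
      simp only [star_mul, star_star, mul_assoc]
      simp only [← mul_assoc (star (fourierColumn N u _)) (fourierColumn N u _), ← Finset.mul_sum,
        ← Finset.sum_mul, sum_star_fourierColumn_mul_self hu, one_mul]
    rw [← h]
    exact norm_compress_le hu fun ζ => (norm_mul_le_of_norm_le_one_left (hX ζ) _).trans
      ((norm_star _).trans_le (hX ζ))
  refine (norm_sum_star_mul_mul_le _ _ _ fun p => hY _ _).trans ?_
  refine (mul_le_of_le_one_left (Real.sqrt_nonneg _) (Real.sqrt_le_one.mpr norm_left_le)).trans ?_
  gcongr
  simp only [add_smul, mul_smul, Finset.sum_add_distrib, ← Finset.smul_sum]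
  have total : ∑ p : ZMod N × ZMod N, star (fourierColumn N u p.2 * fourierColumn N u p.1) *
      (fourierColumn N u p.2 * fourierColumn N u p.1) = 1 := by
    simp only [star_fourierColumn_mul_fourierColumn_mul_self hu, Fintype.sum_prod_type]
    rw [← Finset.sum_mul_sum, sum_star_fourierColumn_mul_self hu, mul_one]
  rw [total]
  refine norm_add_le_of_le ?_ ?_
  · rw [norm_smul, norm_one, mul_one, Real.norm_of_nonneg hδ]
  · rw [norm_smul, Real.norm_of_nonneg hC]
    gcongr
    exact norm_sum_norm_toCircle_sub_sq_smul_le hu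

/-- In `compress_mul_compress_sub` the difference `Y(ζ_s) - Y(ζ_r)` is small near the diagonal,
while away from it the coefficients are small in quadratic mean. -/
theorem norm_compress_mul_compress_sub_le (hu : u ∈ unitary A) {X Y : Circle → A}
    (hX : ∀ ζ, ‖X ζ‖ ≤ 1) {δ C η : ℝ} (hδ : 0 ≤ δ) (hC : 0 ≤ C)
    (hY : ∀ ζ ξ : Circle, ‖Y ξ - Y ζ‖ ^ 2 ≤ δ + C * ‖(ζ : ℂ) - ξ‖ ^ 2)
    (huY : ∀ r : ZMod N, ‖u * Y (ZMod.toCircle r) - Y (ZMod.toCircle r) * u‖ ≤ η) :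
    ‖compress N u X * compress N u Y - compress N u (X * Y)‖ ≤
      2 * N ^ 3 * η + √(δ + C * (8 / N)) := by
  have norm_le (r : ZMod N) := norm_fourierColumn_le_one (N := N) hu r
  have norm_star_le (r : ZMod N) : ‖star (fourierColumn N u r)‖ ≤ 1 :=
    (norm_star _).trans_le (norm_le r)
  have scale (r : ZMod N) : N * ‖u * Y (ZMod.toCircle r) - Y (ZMod.toCircle r) * u‖ ≤ N * η :=
    mul_le_mul_of_nonneg_left (huY r) (Nat.cast_nonneg N)
  rw [compress_mul_compress_sub hu]
  calc _ ≤ ∑ _p : ZMod N × ZMod N, (N * η + N * η) + √(δ + C * (8 / N)) := by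
        refine norm_add_le_of_le (norm_sum_le_of_le _ fun p _ => norm_add_le_of_le ?_ ?_)
          (norm_sum_mul_sub_mul_le hu hX hδ hC hY)
        · exact (norm_mul_le_of_norm_le_one_left (norm_star_le _) _).trans <|
            (norm_mul_le_of_norm_le_one_left (hX _) _).trans <|
            (norm_mul_le_of_norm_le_one_left (norm_star_le _) _).trans <|
            (norm_mul_le_of_norm_le_one_right (norm_le _) _).trans <|
            (norm_fourierColumn_mul_sub_mul_le hu hu _ _).trans (scale _)
        · exact (norm_mul_le_of_norm_le_one_left (norm_star_le _) _).trans <|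
            (norm_mul_le_of_norm_le_one_left (hX _) _).trans <|
            (norm_mul_le_of_norm_le_one_right (norm_le _) _).trans <|
            (norm_mul_le_of_norm_le_one_right (norm_le _) _).trans <|
            (norm_star_fourierColumn_mul_sub_mul_le hu hu _ _).trans (scale _)
    _ = 2 * N ^ 3 * η + √(δ + C * (8 / N)) := by
        rw [Finset.sum_const, Finset.card_univ, Fintype.card_prod, ZMod.card, nsmul_eq_mul]
        push_cast
        ring

end Compress

/-! ### Central matrix units -/

section CentralMatrixUnits

theorem norm_mul_sub_mul_le_add {A : Type*} [NonUnitalSeminormedRing A] (p e a : A) :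
    ‖e * a - a * e‖ ≤ ‖p * a - a * p‖ + 2 * ‖a‖ * ‖e - p‖ := by
  have decomp : e * a - a * e = (p * a - a * p) + ((e - p) * a - a * (e - p)) := by
    simp only [mul_sub, sub_mul]
    abel
  rw [decomp]
  refine norm_add_le_of_le le_rfl
    ((norm_sub_le_of_le (norm_mul_le _ _) (norm_mul_le _ _)).trans_eq ?_)
  ring

variable {A : Type*} [CStarAlgebra A] {n : ℕ}

/-- Every finite subset of `A` almost commutes with a unital copy of `M_n` in `A`. -/
def HasCentralMatrixUnits (n : ℕ) (A : Type*) [CStarAlgebra A] : Prop :=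
  ∀ (F : Finset A) (ε : ℝ), 0 < ε → ∃ φ : Matrix (Fin n) (Fin n) ℂ →⋆ₐ[ℂ] A,
    ∀ i j, ∀ a ∈ F, ‖φ (Matrix.single i j 1) * a - a * φ (Matrix.single i j 1)‖ < ε

theorem eq_sum_smul_single {R : Type*} [Semiring R] {m : Type*} [Fintype m] [DecidableEq m]
    (M : Matrix m m R) : M = ∑ i, ∑ j, M i j • Matrix.single i j (1 : R) := by
  simpa only [Matrix.smul_single, smul_eq_mul, mul_one] using Matrix.matrix_eq_sum_single M

theorem star_map_single (φ : Matrix (Fin n) (Fin n) ℂ →⋆ₐ[ℂ] A) (i j : Fin n) :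
    star (φ (Matrix.single i j 1)) = φ (Matrix.single j i 1) := by
  rw [← map_star, Matrix.star_eq_conjTranspose, Matrix.conjTranspose_single, star_one]

theorem norm_map_single_le_one (φ : Matrix (Fin n) (Fin n) ℂ →⋆ₐ[ℂ] A) (i j : Fin n) :
    ‖φ (Matrix.single i j 1)‖ ≤ 1 := by
  have hproj : IsStarProjection (φ (Matrix.single j j 1)) := by
    refine ⟨?_, star_map_single φ j j⟩
    rw [IsIdempotentElem, ← map_mul, Matrix.single_mul_single_same, one_mul]
  have hnorm := hproj.norm_le
  rw [← one_mul (1 : ℂ), ← Matrix.single_mul_single_same 1 j i j 1, map_mul,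
    ← star_map_single φ i j, CStarRing.norm_star_mul_self] at hnorm
  exact (pow_le_one_iff_of_nonneg (norm_nonneg _) two_ne_zero).mp ((sq _).trans_le hnorm)

theorem norm_map_mul_sub_mul_map_le (φ : Matrix (Fin n) (Fin n) ℂ →⋆ₐ[ℂ] A) {a : A} {c : ℝ}
    (h : ∀ i j, ‖φ (Matrix.single i j 1) * a - a * φ (Matrix.single i j 1)‖ ≤ c)
    (M : Matrix (Fin n) (Fin n) ℂ) :
    ‖φ M * a - a * φ M‖ ≤ (∑ i, ∑ j, ‖M i j‖) * c := by
  have decomp : φ M * a - a * φ M = ∑ i, ∑ j, M i j •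
      (φ (Matrix.single i j 1) * a - a * φ (Matrix.single i j 1)) := by
    conv_lhs => rw [eq_sum_smul_single M]
    simp only [map_sum, map_smul, Finset.sum_mul, Finset.mul_sum, smul_sub, smul_mul_assoc,
      mul_smul_comm, Finset.sum_sub_distrib]
  rw [decomp, Finset.sum_mul]
  refine norm_sum_le_of_le _ fun i _ => ?_
  rw [Finset.sum_mul]
  refine norm_sum_le_of_le _ fun j _ => ?_
  rw [norm_smul]
  exact mul_le_mul_of_nonneg_left (h i j) (norm_nonneg _)

theorem HasCentralMatrixUnits.exists_of_isCompact (hA : HasCentralMatrixUnits n A) {K : Set A}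
    (hK : IsCompact K) {ε : ℝ} (hε : 0 < ε) :
    ∃ φ : Matrix (Fin n) (Fin n) ℂ →⋆ₐ[ℂ] A, ∀ i j, ∀ a ∈ K,
      ‖φ (Matrix.single i j 1) * a - a * φ (Matrix.single i j 1)‖ ≤ ε := by
  obtain ⟨t, -, ht, hcover⟩ := hK.finite_cover_balls (e := ε / 3) (by positivity)
  obtain ⟨φ, hφ⟩ := hA ht.toFinset (ε / 3) (by positivity)
  refine ⟨φ, fun i j a ha => ?_⟩
  obtain ⟨f, hf, hfa⟩ := Set.mem_iUnion₂.mp (hcover ha)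
  rw [Metric.mem_ball, dist_eq_norm] at hfa
  have hφf := hφ i j f (ht.mem_toFinset.mpr hf)
  have norm_le := norm_map_single_le_one φ i j
  generalize φ (Matrix.single i j 1) = p at *
  calc ‖p * a - a * p‖ = ‖a * p - p * a‖ := norm_sub_rev ..
    _ ≤ ‖f * p - p * f‖ + 2 * ‖p‖ * ‖a - f‖ := norm_mul_sub_mul_le_add ..
    _ ≤ ε / 3 + 2 * 1 * (ε / 3) := by
        rw [norm_sub_rev (f * p)]
        gcongr
    _ = ε := by ring

end CentralMatrixUnits

section RootProjection

variable {n : ℕ}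

/-- The projection in `M_n` onto the line spanned by `(1, ζ, …, ζ^{n-1})`. Multiplying `ζ` by the
`n`-th roots of unity gives the spectral projections of a conjugate of the cyclic shift. -/
noncomputable def rootProjection (n : ℕ) (ζ : Circle) : Matrix (Fin n) (Fin n) ℂ :=
  (n : ℂ)⁻¹ • Matrix.vecMulVec (fun i : Fin n => (ζ : ℂ) ^ (i : ℕ))
    (star fun i : Fin n => (ζ : ℂ) ^ (i : ℕ))

theorem rootProjection_apply (ζ : Circle) (i j : Fin n) :
    rootProjection n ζ i j = (n : ℂ)⁻¹ * ((ζ : ℂ) ^ (i : ℕ) * star (ζ : ℂ) ^ (j : ℕ)) := by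
  simp only [rootProjection, Matrix.smul_apply, Matrix.vecMulVec_apply, Pi.star_apply, star_pow,
    smul_eq_mul]

theorem isSelfAdjoint_rootProjection (ζ : Circle) : IsSelfAdjoint (rootProjection n ζ) := by
  rw [IsSelfAdjoint, rootProjection, star_smul, Matrix.star_eq_conjTranspose,
    Matrix.conjTranspose_vecMulVec, star_star, star_inv₀, star_natCast]

theorem sum_norm_rootProjection_apply [NeZero n] (ζ : Circle) :
    ∑ i, ∑ j, ‖rootProjection n ζ i j‖ = n := by
  have hn : (n : ℝ) ≠ 0 := NeZero.ne _
  simp only [rootProjection_apply, norm_mul, norm_pow, norm_star, Circle.norm_coe, one_pow, mul_one,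
    norm_inv, Complex.norm_natCast, Finset.sum_const, Finset.card_univ, Fintype.card_fin,
    nsmul_eq_mul, mul_inv_cancel₀ hn]

theorem continuous_rootProjection (n : ℕ) : Continuous (rootProjection n) :=
  continuous_matrix fun i j => by
    simp only [rootProjection_apply]
    fun_prop

variable [NeZero n]

theorem sum_toCircle_pow (r : ZMod n) :
    ∑ l : Fin n, (ZMod.toCircle r : ℂ) ^ (l : ℕ) = if r = 0 then (n : ℂ) else 0 := by
  rw [Fin.sum_univ_eq_sum_range fun l => (ZMod.toCircle r : ℂ) ^ l]
  split_ifs with hr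
  · simp only [hr, AddChar.map_zero_eq_one, Circle.coe_one, one_pow, Finset.sum_const,
      Finset.card_range, nsmul_eq_mul, mul_one]
  · have hne : (ZMod.toCircle r : ℂ) ≠ 1 := by
      rw [← Circle.coe_one, ← AddChar.map_zero_eq_one (ZMod.toCircle (N := n))]
      exact fun h => hr (ZMod.injective_toCircle (Circle.ext h))
    rw [geom_sum_eq hne, coe_toCircle_pow_card, sub_self, zero_div]

theorem rootProjection_mul (ζ : Circle) (g h : ZMod n) :
    rootProjection n (ζ * (ZMod.toCircle g)⁻¹) * rootProjection n (ζ * (ZMod.toCircle h)⁻¹) =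
      if g = h then rootProjection n (ζ * (ZMod.toCircle g)⁻¹) else 0 := by
  have coe_eq : star ((ζ * (ZMod.toCircle g)⁻¹ : Circle) : ℂ) *
      ((ζ * (ZMod.toCircle h)⁻¹ : Circle) : ℂ) = ZMod.toCircle (g - h) := by
    rw [AddChar.map_sub_eq_div, ← starRingEnd_apply, ← Circle.coe_inv_eq_conj, ← Circle.coe_mul]
    congr 1
    rw [mul_inv, inv_inv, mul_mul_mul_comm, inv_mul_cancel, one_mul, div_eq_mul_inv]
  have inner_eq : star (fun i : Fin n => ((ζ * (ZMod.toCircle g)⁻¹ : Circle) : ℂ) ^ (i : ℕ)) ⬝ᵥ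
      (fun i : Fin n => ((ζ * (ZMod.toCircle h)⁻¹ : Circle) : ℂ) ^ (i : ℕ)) =
        if g = h then (n : ℂ) else 0 := by
    simp only [dotProduct, Pi.star_apply, star_pow, ← mul_pow, coe_eq, sum_toCircle_pow,
      sub_eq_zero]
  have hn : (n : ℂ) ≠ 0 := NeZero.ne _
  rw [rootProjection, rootProjection, smul_mul_smul_comm, Matrix.vecMulVec_mul_vecMulVec, inner_eq]
  split_ifs with hgh
  · rw [hgh, Matrix.vecMulVec_smul, smul_smul, mul_assoc, inv_mul_cancel₀ hn, mul_one]
  · rw [zero_smul, Matrix.vecMulVec_zero, smul_zero]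

theorem sum_rootProjection (ζ : Circle) :
    ∑ g : ZMod n, rootProjection n (ζ * (ZMod.toCircle g)⁻¹) = 1 := by
  have entry (g : ZMod n) (i j : Fin n) : rootProjection n (ζ * (ZMod.toCircle g)⁻¹) i j =
      rootProjection n ζ i j *
        (star (ZMod.toCircle g : ℂ) ^ (i : ℕ) * (ZMod.toCircle g : ℂ) ^ (j : ℕ)) := by
    simp only [rootProjection_apply, Circle.coe_mul, Circle.coe_inv_eq_conj, star_mul,
      starRingEnd_apply, star_star, mul_pow]
    ring
  ext i j
  simp only [Matrix.sum_apply, entry, ← Finset.mul_sum,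
    sum_star_toCircle_pow_mul_toCircle_pow i.2 j.2, Fin.val_inj, Matrix.one_apply]
  split_ifs with hij
  · have hn : (n : ℂ) ≠ 0 := NeZero.ne _
    rw [rootProjection_apply, hij, ← mul_pow, ← starRingEnd_apply, Complex.mul_conj,
      Circle.normSq_coe, Complex.ofReal_one, one_pow, mul_one, inv_mul_cancel₀ hn]
  · rw [mul_zero]

end RootProjection

/-! ### From central matrix units to Rokhlin projections -/

section OrbitProjection

variable {A : Type*} [CStarAlgebra A] {n : ℕ} [NeZero n]

/-- The function `ζ ↦ α_ζ(φ(p(ζ ω_g⁻¹)))`, where `p` is `rootProjection` and `ω_g` the `n`-th root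
of unity of index `g`. Translating the argument by `ω_g` shifts the index by `g`, which is how these
projections carry the symmetry of the Rokhlin projections to be constructed. -/
noncomputable def orbitProjection (α : Circle →* (A ≃⋆ₐ[ℂ] A))
    (φ : Matrix (Fin n) (Fin n) ℂ →⋆ₐ[ℂ] A) (g : ZMod n) (ζ : Circle) : A :=
  α ζ (φ (rootProjection n (ζ * (ZMod.toCircle g)⁻¹)))

variable (α : Circle →* (A ≃⋆ₐ[ℂ] A)) (φ : Matrix (Fin n) (Fin n) ℂ →⋆ₐ[ℂ] A)

theorem isSelfAdjoint_orbitProjection (g : ZMod n) (ζ : Circle) :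
    IsSelfAdjoint (orbitProjection α φ g ζ) :=
  ((isSelfAdjoint_rootProjection _).map φ).map (α ζ)

theorem orbitProjection_mul (g h : ZMod n) :
    orbitProjection α φ g * orbitProjection α φ h =
      if g = h then orbitProjection α φ g else 0 := by
  funext ζ
  simp only [Pi.mul_apply, orbitProjection, ← map_mul, rootProjection_mul]
  split_ifs
  · rfl
  · rw [map_zero, map_zero, Pi.zero_apply]

theorem sum_orbitProjection : ∑ g, orbitProjection α φ g = 1 := by
  funext ζ
  simp only [Finset.sum_apply, orbitProjection, ← map_sum, sum_rootProjection, map_one,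
    Pi.one_apply]

theorem norm_orbitProjection_le_one (g : ZMod n) (ζ : Circle) :
    ‖orbitProjection α φ g ζ‖ ≤ 1 :=
  IsStarProjection.norm_le _ ⟨(congrFun (orbitProjection_mul α φ g g) ζ).trans (by rw [if_pos rfl]),
    isSelfAdjoint_orbitProjection α φ g ζ⟩

theorem map_toCircle_orbitProjection (g h : ZMod n) (ζ : Circle) :
    α (ZMod.toCircle g) (orbitProjection α φ h ζ) =
      orbitProjection α φ (g + h) (ζ * ZMod.toCircle g) := by
  have arg_eq : ζ * (ZMod.toCircle h)⁻¹ =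
      ζ * ZMod.toCircle g * (ZMod.toCircle (g + h))⁻¹ := by
    rw [AddChar.map_add_eq_mul, mul_inv, mul_assoc, mul_inv_cancel_left]
  rw [orbitProjection, orbitProjection, arg_eq, mul_comm ζ (ZMod.toCircle g), map_mul,
    StarAlgEquiv.mul_apply]

theorem norm_orbitProjection_mul_sub_mul_le {a : A} {c : ℝ} (ζ : Circle)
    (h : ∀ i j, ‖φ (Matrix.single i j 1) * α ζ⁻¹ a - α ζ⁻¹ a * φ (Matrix.single i j 1)‖ ≤ c)
    (g : ZMod n) :
    ‖orbitProjection α φ g ζ * a - a * orbitProjection α φ g ζ‖ ≤ n * c := by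
  have map_inv_apply : α ζ (α ζ⁻¹ a) = a := by
    rw [← StarAlgEquiv.mul_apply, ← map_mul, mul_inv_cancel, map_one, StarAlgEquiv.one_apply]
  nth_rewrite 1 2 [← map_inv_apply]
  rw [orbitProjection, ← map_mul, ← map_mul, ← map_sub,
    NonUnitalStarAlgHom.norm_map (α ζ) (α ζ).injective]
  exact (norm_map_mul_sub_mul_map_le φ h _).trans_eq (by rw [sum_norm_rootProjection_apply])

theorem continuous_orbitProjection (hcont : ∀ a : A, Continuous fun ζ : Circle => α ζ a)
    (g : ZMod n) : Continuous (orbitProjection α φ g) := by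
  have expand (ζ : Circle) : orbitProjection α φ g ζ =
      ∑ i, ∑ j, rootProjection n (ζ * (ZMod.toCircle g)⁻¹) i j •
        α ζ (φ (Matrix.single i j 1)) := by
    conv_lhs => rw [orbitProjection, eq_sum_smul_single (rootProjection n _)]
    simp only [map_sum, map_smul]
  have entry (i j : Fin n) :
      Continuous fun ζ : Circle => rootProjection n (ζ * (ZMod.toCircle g)⁻¹) i j :=
    ((continuous_rootProjection n).comp (continuous_mul_const _)).matrix_elem i j
  simp only [funext expand]
  exact continuous_finsetSum _ fun i _ => continuous_finsetSum _ fun j _ =>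
    (entry i j).smul (hcont _)

end OrbitProjection

section Rokhlin

theorem exists_dist_sq_le_add_mul_dist_sq {X E : Type*} [PseudoMetricSpace X] [CompactSpace X]
    [PseudoMetricSpace E] {f : X → E} (hf : Continuous f) {δ : ℝ} (hδ : 0 < δ) :
    ∃ C : ℝ, 0 ≤ C ∧ ∀ x y, dist (f x) (f y) ^ 2 ≤ δ + C * dist x y ^ 2 := by
  obtain ⟨η, hη, near⟩ := Metric.uniformContinuous_iff.mp
    (CompactSpace.uniformContinuous_of_continuous hf) (√δ) (Real.sqrt_pos.mpr hδ)
  obtain ⟨B, hB⟩ := Metric.isBounded_iff.mp (isCompact_range hf).isBounded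
  refine ⟨B ^ 2 / η ^ 2, by positivity, fun x y => ?_⟩
  rcases lt_or_ge (dist x y) η with hlt | hge
  · calc dist (f x) (f y) ^ 2 ≤ √δ ^ 2 := pow_le_pow_left₀ dist_nonneg (near hlt).le 2
      _ = δ := Real.sq_sqrt hδ.le
      _ ≤ δ + B ^ 2 / η ^ 2 * dist x y ^ 2 := le_add_of_nonneg_right (by positivity)
  · calc dist (f x) (f y) ^ 2 ≤ B ^ 2 :=
          pow_le_pow_left₀ dist_nonneg (hB (Set.mem_range_self x) (Set.mem_range_self y)) 2
      _ = B ^ 2 / η ^ 2 * η ^ 2 := (div_mul_cancel₀ _ (by positivity)).symm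
      _ ≤ B ^ 2 / η ^ 2 * dist x y ^ 2 := by gcongr
      _ ≤ δ + B ^ 2 / η ^ 2 * dist x y ^ 2 := le_add_of_nonneg_left hδ.le

theorem exists_dvd_mul_div_lt (n : ℕ) [NeZero n] (C : ℝ) {δ : ℝ} (hδ : 0 < δ) :
    ∃ N : ℕ, N ≠ 0 ∧ n ∣ N ∧ C * (8 / N) < δ := by
  obtain ⟨m, hm⟩ := exists_nat_gt (C * 8 / δ)
  have hle : m ≤ n * (m + 1) := m.le_succ.trans (Nat.le_mul_of_pos_left _ (NeZero.pos n))
  have hN : n * (m + 1) ≠ 0 := mul_ne_zero (NeZero.ne n) m.succ_ne_zero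
  refine ⟨n * (m + 1), hN, dvd_mul_right .., ?_⟩
  rw [mul_div_assoc', div_lt_comm₀ (Nat.cast_pos.mpr (Nat.pos_of_ne_zero hN)) hδ]
  exact hm.trans_le (Nat.cast_le.mpr hle)

theorem coe_mem_unitary (ζ : Circle) : (ζ : ℂ) ∈ unitary ℂ := by
  rw [Unitary.mem_iff_self_mul_star, ← starRingEnd_apply, Complex.mul_conj, Circle.normSq_coe,
    Complex.ofReal_one]

theorem exists_toCircle_eq_of_dvd {n N : ℕ} [NeZero n] [NeZero N] (h : n ∣ N) (g : ZMod n) :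
    ∃ r : ZMod N, ZMod.toCircle r = ZMod.toCircle g := by
  obtain ⟨m, rfl⟩ := h
  have hm : (m : ℂ) ≠ 0 := Nat.cast_ne_zero.mpr (right_ne_zero_of_mul (NeZero.ne (n * m)))
  have hn : (n : ℂ) ≠ 0 := NeZero.ne _
  refine ⟨((m * g.val : ℕ) : ZMod (n * m)), Circle.ext ?_⟩
  rw [ZMod.toCircle_natCast, ZMod.toCircle_apply]
  congr 1
  push_cast
  field_simp

theorem exists_pos_forall_norm_mul_le {A : Type*} [SeminormedAddCommGroup A] (F : Finset A) {ε : ℝ}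
    (hε : 0 < ε) : ∃ τ > 0, τ ≤ ε ∧ ∀ a ∈ F, ‖a‖ * τ ≤ ε := by
  have sum_nonneg : 0 ≤ ∑ a ∈ F, ‖a‖ := Finset.sum_nonneg fun _ _ => norm_nonneg _
  have norm_le (a) (ha : a ∈ F) : ‖a‖ ≤ 1 + ∑ a ∈ F, ‖a‖ :=
    (Finset.single_le_sum (fun a _ => norm_nonneg a) ha).trans (le_add_of_nonneg_left zero_le_one)
  refine ⟨ε / (1 + ∑ a ∈ F, ‖a‖), by positivity, div_le_self hε.le (by linarith), fun a ha => ?_⟩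
  rw [mul_div_left_comm]
  exact mul_le_of_le_one_right hε.le (div_le_one_of_le₀ (norm_le a ha) (by positivity))

variable {A : Type*} [CStarAlgebra A] [Nontrivial A] {α : Circle →* (A ≃⋆ₐ[ℂ] A)}

theorem norm_map_compress_sub_le {N : ℕ} [NeZero N] {u : A} (hu : u ∈ unitary A)
    {X : Circle → A} (hX : ∀ ζ, ‖X ζ‖ ≤ 1) (r : ZMod N) (f : A →⋆ₐ[ℂ] A) :
    ‖f (compress N u X) - compress N u fun ζ => f (X (ζ * (ZMod.toCircle r)⁻¹))‖ ≤
      2 * N ^ 2 * ‖f u - (ZMod.toCircle r : ℂ) • u‖ := by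
  have smul_mem : (ZMod.toCircle r : ℂ) • u ∈ unitary A :=
    Unitary.smul_mem_of_mem (coe_mem_unitary _) hu
  have h := norm_compress_mul_sub_mul_compress_le (N := N) (Unitary.map_mem f hu) smul_mem
    (X := f ∘ X) (fun ζ => (NonUnitalStarAlgHom.norm_apply_le f _).trans (hX ζ)) 1 (c := 0)
    fun ζ => by rw [mul_one, one_mul, sub_self, norm_zero]
  rw [compress_toCircle_smul] at h
  simpa only [mul_one, one_mul, add_zero, map_compress, Function.comp_apply] using h

theorem CircleRokhlinProperty.exists_compress (hα : CircleRokhlinProperty α) {ι : Type*} [Finite ι]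
    {X : ι → Circle → A} (hX : ∀ i, Continuous (X i)) (hX1 : ∀ i ζ, ‖X i ζ‖ ≤ 1)
    (n : ℕ) [NeZero n] (F : Finset A) {δ : ℝ} (hδ : 0 < δ) :
    ∃ (N : ℕ) (_ : NeZero N), n ∣ N ∧ ∃ u ∈ unitary A,
      (∀ i j, ‖compress N u (X i) * compress N u (X j) - compress N u (X i * X j)‖ < δ) ∧
      (∀ i (r : ZMod N), ‖α (ZMod.toCircle r) (compress N u (X i)) -
        compress N u fun ζ => α (ZMod.toCircle r) (X i (ζ * (ZMod.toCircle r)⁻¹))‖ < δ) ∧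
      ∀ i, ∀ a ∈ F, ∀ c, (∀ ζ, ‖X i ζ * a - a * X i ζ‖ ≤ c) →
        ‖compress N u (X i) * a - a * compress N u (X i)‖ < δ + c := by
  classical
  have := Fintype.ofFinite ι
  obtain ⟨C, hC, modulus⟩ := exists_dist_sq_le_add_mul_dist_sq
    (continuous_pi hX : Continuous fun ζ i => X i ζ) (δ := δ ^ 2 / 8) (by positivity)
  obtain ⟨N, hN, hnN, hCN⟩ := exists_dvd_mul_div_lt n C (δ := δ ^ 2 / 8) (by positivity)
  have : NeZero N := ⟨hN⟩
  have hN1 : (1 : ℝ) ≤ N := Nat.one_le_cast.mpr (Nat.pos_of_ne_zero hN)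
  set η : ℝ := δ / (4 * N ^ 3) with hη
  have cube_mul_η : 2 * N ^ 3 * η = δ / 2 := by rw [hη]; field_simp; norm_num
  have sq_mul_η : 2 * N ^ 2 * η ≤ δ / 2 := by
    rw [← cube_mul_η]
    gcongr
    norm_num
  obtain ⟨u, hu, u_equivariant, u_central⟩ := hα
    (F ∪ Finset.univ.image fun p : ι × ZMod N => X p.1 (ZMod.toCircle p.2)) η (by positivity)
  refine ⟨N, this, hnN, u, hu, fun i j => ?_, fun i r => ?_, fun i a ha c hc => ?_⟩
  · have modulus_apply (ζ ξ : Circle) :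
        ‖X j ξ - X j ζ‖ ^ 2 ≤ δ ^ 2 / 8 + C * ‖(ζ : ℂ) - ξ‖ ^ 2 := by
      rw [← dist_eq_norm, ← dist_eq_norm, dist_comm (ζ : ℂ)]
      exact (pow_le_pow_left₀ dist_nonneg (dist_le_pi_dist (fun i => X i ξ) (fun i => X i ζ) j)
        2).trans (modulus ξ ζ)
    refine (norm_compress_mul_compress_sub_le hu (hX1 i) (by positivity) hC modulus_apply
      fun r => (u_central _ (Finset.mem_union_right _
        (Finset.mem_image_of_mem _ (Finset.mem_univ (j, r))))).le).trans_lt ?_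
    have sqrt_lt : √(δ ^ 2 / 8 + C * (8 / N)) < δ / 2 := by
      rw [Real.sqrt_lt' (by positivity)]
      linarith [hCN]
    linarith
  · refine (norm_map_compress_sub_le hu (hX1 i) r
      (StarAlgEquiv.toStarAlgHom (α (ZMod.toCircle r)))).trans_lt ?_
    refine (mul_le_mul_of_nonneg_left (u_equivariant _).le (by positivity)).trans_lt ?_
    linarith
  · refine (norm_compress_mul_sub_mul_compress_le hu hu (hX1 i) a hc).trans_lt ?_
    have := mul_le_mul_of_nonneg_left (u_central a (Finset.mem_union_left _ ha)).le
      (by positivity : (0 : ℝ) ≤ 2 * N ^ 2)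
    linarith

/-- The Rokhlin conditions of `FiniteRokhlinProperty`, additively indexed, hold approximately for
the compressions of `orbitProjection`. -/
theorem CircleRokhlinProperty.exists_approximate_projections (hα : CircleRokhlinProperty α)
    (hcont : ∀ a : A, Continuous fun ζ : Circle => α ζ a) {n : ℕ} [NeZero n]
    (hA : HasCentralMatrixUnits n A) (F : Finset A) {δ : ℝ} (hδ : 0 < δ) :
    ∃ p : ZMod n → A, (∀ g, IsSelfAdjoint (p g)) ∧ ∑ g, p g = 1 ∧ (∀ g, ‖p g‖ ≤ 1) ∧
      (∀ g h, ‖p g * p h - if g = h then p g else 0‖ < δ) ∧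
      (∀ g h, ‖α (ZMod.toCircle g) (p h) - p (g + h)‖ < δ) ∧
      ∀ g, ∀ a ∈ F, ‖p g * a - a * p g‖ < δ := by
  have hn : (n : ℝ) ≠ 0 := NeZero.ne _
  obtain ⟨φ, hφ⟩ := hA.exists_of_isCompact
    (F.finite_toSet.isCompact_biUnion fun a _ => isCompact_range (hcont a))
    (ε := δ / 2 / n) (by positivity)
  obtain ⟨N, _, hnN, u, hu, approx_mul, approx_equivariant, approx_central⟩ :=
    hα.exists_compress (X := orbitProjection α φ) (continuous_orbitProjection α φ hcont)
      (norm_orbitProjection_le_one α φ) n F (half_pos hδ)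
  refine ⟨fun g => compress N u (orbitProjection α φ g),
    fun g => isSelfAdjoint_compress u (isSelfAdjoint_orbitProjection α φ g), ?_,
    fun g => norm_compress_le hu (norm_orbitProjection_le_one α φ g), fun g h => ?_, fun g h => ?_,
    fun g a ha => ?_⟩
  · rw [sum_compress, sum_orbitProjection, compress_one hu]
  · have h := (approx_mul g h).trans (half_lt_self hδ)
    rwa [orbitProjection_mul, apply_ite (compress N u), compress_zero] at h
  · obtain ⟨r, hr⟩ := exists_toCircle_eq_of_dvd hnN g
    have h := (approx_equivariant h r).trans (half_lt_self hδ)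
    simpa only [hr, map_toCircle_orbitProjection, inv_mul_cancel_right] using h
  · have h := approx_central g a ha _ fun ζ => norm_orbitProjection_mul_sub_mul_le α φ ζ
      (fun i j => hφ i j _ (Set.mem_biUnion ha (Set.mem_range_self ζ⁻¹))) g
    rwa [mul_div_cancel₀ _ hn, add_halves] at h

theorem finiteRokhlinProperty_of_hasCentralMatrixUnits (hα : CircleRokhlinProperty α)
    (hcont : ∀ a : A, Continuous fun ζ : Circle => α ζ a) (n : ℕ) [NeZero n]
    (hA : HasCentralMatrixUnits n A) : FiniteRokhlinProperty (restrictCyclic α n) := by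
  intro F ε hε
  obtain ⟨τ, hτ, τ_le, norm_mul_τ_le⟩ :=
    exists_pos_forall_norm_mul_le F (ε := ε / 8) (by positivity)
  obtain ⟨δ, hδ, straighten⟩ := exists_projections_near (A := A) (ι := ZMod n) hτ
  obtain ⟨p, p_selfAdjoint, p_sum, p_norm, p_mul, p_equivariant, p_central⟩ :=
    hα.exists_approximate_projections hcont hA F (δ := min δ (ε / 2)) (by positivity)
  obtain ⟨e, e_selfAdjoint, he, e_near⟩ := straighten p p_selfAdjoint p_sum p_norm
    fun g h => (p_mul g h).trans_le (min_le_left _ _)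
  refine ⟨fun g => e g.toAdd, fun g => ⟨he.idem _, e_selfAdjoint _⟩, fun g h hgh => he.ortho hgh,
    fun g h => ?_, fun g a ha => ?_, (Equiv.sum_comp Multiplicative.toAdd e).trans he.complete⟩
  · change ‖α (ZMod.toCircle g.toAdd) (e h.toAdd) - e (g.toAdd + h.toAdd)‖ < ε
    generalize g.toAdd = g, h.toAdd = h
    have map_near : ‖α (ZMod.toCircle g) (e h - p h)‖ < τ := by
      rw [NonUnitalStarAlgHom.norm_map (α (ZMod.toCircle g)) (α (ZMod.toCircle g)).injective]
      exact e_near h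
    have decomp : α (ZMod.toCircle g) (e h) - e (g + h) = α (ZMod.toCircle g) (e h - p h) +
        (α (ZMod.toCircle g) (p h) - p (g + h)) - (e (g + h) - p (g + h)) := by
      rw [map_sub]
      abel
    rw [decomp]
    calc _ ≤ τ + ε / 2 + τ := norm_sub_le_of_le (norm_add_le_of_le
          map_near.le ((p_equivariant g h).le.trans (min_le_right _ _))) (e_near _).le
      _ < ε := by linarith
  · calc ‖e g.toAdd * a - a * e g.toAdd‖
        ≤ ‖p g.toAdd * a - a * p g.toAdd‖ + 2 * ‖a‖ * ‖e g.toAdd - p g.toAdd‖ :=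
          norm_mul_sub_mul_le_add ..
      _ ≤ ε / 2 + 2 * ‖a‖ * τ := by
          gcongr
          · exact (p_central _ a ha).le.trans (min_le_right _ _)
          · exact (e_near _).le
      _ < ε := by linarith [norm_mul_τ_le a ha]

end Rokhlin

section Generators

open Filter Topology

variable {n : ℕ} {A : Type*} [CStarAlgebra A]

/-- The *-algebra of elements commuting asymptotically along `l` with the matrix units of the
copies `Φ p` of `M_n`. -/
def asymptoticCommutant {β : Type*} (l : Filter β)
    (Φ : β → Matrix (Fin n) (Fin n) ℂ →⋆ₐ[ℂ] A) : StarSubalgebra ℂ A where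
  carrier := {x | ∀ i j, Tendsto
    (fun p => Φ p (Matrix.single i j 1) * x - x * Φ p (Matrix.single i j 1)) l (𝓝 0)}
  mul_mem' {x y} hx hy i j := by
    have lim := ((hx i j).mul_const y).add ((hy i j).const_mul x)
    rw [zero_mul, mul_zero, add_zero] at lim
    refine lim.congr fun p => ?_
    simp only [mul_sub, sub_mul, mul_assoc]
    abel
  add_mem' {x y} hx hy i j := by
    have lim := (hx i j).add (hy i j)
    rw [add_zero] at lim
    refine lim.congr fun p => ?_
    simp only [mul_add, add_mul]
    abel
  algebraMap_mem' r i j := by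
    simp only [Algebra.algebraMap_eq_smul_one, mul_smul_comm, smul_mul_assoc, mul_one, one_mul,
      sub_self, tendsto_const_nhds]
  star_mem' {x} hx i j := by
    have lim := (hx j i).star.neg
    rw [star_zero, neg_zero] at lim
    refine lim.congr fun p => ?_
    rw [star_sub, star_mul, star_mul, star_map_single, neg_sub]

theorem isClosed_asymptoticCommutant {β : Type*} (l : Filter β)
    (Φ : β → Matrix (Fin n) (Fin n) ℂ →⋆ₐ[ℂ] A) :
    IsClosed (asymptoticCommutant l Φ : Set A) := by
  refine isClosed_of_closure_subset fun x hx i j => Metric.tendsto_nhds.mpr fun ε hε => ?_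
  obtain ⟨y, hy, hxy⟩ := Metric.mem_closure_iff.mp hx (ε / 4) (by positivity)
  rw [dist_eq_norm] at hxy
  filter_upwards [Metric.tendsto_nhds.mp (hy i j) (ε / 4) (by positivity)] with p hp
  rw [dist_zero_right] at hp ⊢
  have norm_le := norm_map_single_le_one (Φ p) i j
  generalize Φ p (Matrix.single i j 1) = e at *
  calc ‖e * x - x * e‖ = ‖x * e - e * x‖ := norm_sub_rev ..
    _ ≤ ‖y * e - e * y‖ + 2 * ‖e‖ * ‖x - y‖ := norm_mul_sub_mul_le_add ..
    _ = ‖e * y - y * e‖ + 2 * ‖e‖ * ‖x - y‖ := by rw [norm_sub_rev]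
    _ ≤ ‖e * y - y * e‖ + 2 * 1 * (ε / 4) := by gcongr
    _ < ε := by linarith

theorem hasCentralMatrixUnits_of_forall_mem_asymptoticCommutant {β : Type*} {l : Filter β} [l.NeBot]
    {Φ : β → Matrix (Fin n) (Fin n) ℂ →⋆ₐ[ℂ] A} (h : ∀ x, x ∈ asymptoticCommutant l Φ) :
    HasCentralMatrixUnits n A := by
  intro F ε hε
  have eventually_lt : ∀ᶠ p in l, ∀ i j, ∀ a ∈ F,
      ‖Φ p (Matrix.single i j 1) * a - a * Φ p (Matrix.single i j 1)‖ < ε := by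
    simp only [eventually_all, eventually_all_finset]
    intro i j a _
    simpa only [dist_zero_right] using Metric.tendsto_nhds.mp (h a i j) ε hε
  obtain ⟨p, hp⟩ := eventually_lt.exists
  exact ⟨Φ p, hp⟩

theorem hasCentralMatrixUnits_of_dense_adjoin (G : Set A)
    (hG : Dense (StarAlgebra.adjoin ℂ G : Set A))
    (h : ∀ (F : Finset A) (ε : ℝ), ↑F ⊆ G → 0 < ε →
      ∃ φ : Matrix (Fin n) (Fin n) ℂ →⋆ₐ[ℂ] A, ∀ i j, ∀ a ∈ F,
        ‖φ (Matrix.single i j 1) * a - a * φ (Matrix.single i j 1)‖ < ε) :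
    HasCentralMatrixUnits n A := by
  classical
  have exists_hom (p : Finset G × ℕ) : ∃ φ : Matrix (Fin n) (Fin n) ℂ →⋆ₐ[ℂ] A, ∀ i j, ∀ a ∈ p.1,
      ‖φ (Matrix.single i j 1) * a - a * φ (Matrix.single i j 1)‖ < 1 / ((p.2 : ℝ) + 1) := by
    obtain ⟨φ, hφ⟩ := h (p.1.image Subtype.val) (1 / ((p.2 : ℝ) + 1)) (by simp) (by positivity)
    exact ⟨φ, fun i j a ha => hφ i j a (Finset.mem_image_of_mem _ ha)⟩
  choose Φ hΦ using exists_hom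
  have generators_le : G ⊆ asymptoticCommutant atTop Φ := by
    intro x hx i j
    have bound_tendsto : Tendsto (fun p : Finset G × ℕ => 1 / ((p.2 : ℝ) + 1)) atTop (𝓝 0) := by
      rw [← prod_atTop_atTop_eq]
      exact tendsto_one_div_add_atTop_nhds_zero_nat.comp tendsto_snd
    refine squeeze_zero_norm' ?_ bound_tendsto
    filter_upwards [eventually_ge_atTop (({⟨x, hx⟩}, 0) : Finset G × ℕ)] with p hp
    exact (hΦ p i j ⟨x, hx⟩ (hp.1 (Finset.mem_singleton_self _))).le
  exact hasCentralMatrixUnits_of_forall_mem_asymptoticCommutant fun x =>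
    closure_minimal (StarAlgebra.adjoin_le generators_le) (isClosed_asymptoticCommutant _ _) (hG x)

theorem dense_adjoin_preimage_val (G : Set A) :
    Dense (StarAlgebra.adjoin ℂ
      ((↑) ⁻¹' G : Set (StarAlgebra.adjoin ℂ G).topologicalClosure) :
        Set (StarAlgebra.adjoin ℂ G).topologicalClosure) := by
  set S := (StarAlgebra.adjoin ℂ G).topologicalClosure
  have image_preimage : S.subtype '' ((↑) ⁻¹' G : Set S) = G := by
    refine Set.image_preimage_eq_of_subset ?_
    rw [StarSubalgebra.coe_subtype, Subtype.range_coe]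
    exact (StarAlgebra.subset_adjoin ℂ G).trans (StarSubalgebra.le_topologicalClosure _)
  have image_adjoin : ((↑) : S → A) '' (StarAlgebra.adjoin ℂ ((↑) ⁻¹' G : Set S) : Set S) =
      (StarAlgebra.adjoin ℂ G : Set A) := by
    have map_adjoin := StarAlgHom.map_adjoin S.subtype ((↑) ⁻¹' G : Set S)
    rw [image_preimage] at map_adjoin
    exact congrArg SetLike.coe map_adjoin
  intro x
  rw [Topology.IsInducing.subtypeVal.closure_eq_preimage_closure_image]
  exact (congrArg closure image_adjoin).ge x.2

theorem HasCentralMatrixUnits.exists_of_map {D : Type*} [CStarAlgebra D]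
    (hD : HasCentralMatrixUnits n D) (j : D →⋆ₐ[ℂ] A) (F : Finset A)
    (hF : ∀ x ∈ F, x ∈ Set.range j ∨ ∀ d, Commute x (j d)) {ε : ℝ} (hε : 0 < ε) :
    ∃ φ : Matrix (Fin n) (Fin n) ℂ →⋆ₐ[ℂ] A, ∀ k l, ∀ a ∈ F,
      ‖φ (Matrix.single k l 1) * a - a * φ (Matrix.single k l 1)‖ < ε := by
  classical
  obtain ⟨F', -, hF'⟩ := Finset.subset_set_image_iff.mp
    (show ↑(F.filter (· ∈ Set.range j)) ⊆ j '' Set.univ by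
      rw [Set.image_univ]
      exact fun x hx => (Finset.mem_filter.mp hx).2)
  obtain ⟨φ, hφ⟩ := hD F' ε hε
  refine ⟨j.comp φ, fun k l a ha => ?_⟩
  rw [StarAlgHom.comp_apply]
  rcases hF a ha with hrange | hcommute
  · obtain ⟨d, hd, rfl⟩ := Finset.mem_image.mp (hF' ▸ Finset.mem_filter.mpr ⟨ha, hrange⟩)
    rw [← map_mul, ← map_mul, ← map_sub]
    exact (NonUnitalStarAlgHom.norm_apply_le j _).trans_lt (hφ k l d hd)
  · rwa [(hcommute _).eq, sub_self, norm_zero]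

theorem dense_adjoin_range_union_range {D C : Type*} [CStarAlgebra D] [CStarAlgebra C]
    {i : A →⋆ₐ[ℂ] C} {j : D →⋆ₐ[ℂ] C} (h : IsCStarTensorProduct i j) :
    Dense (StarAlgebra.adjoin ℂ (Set.range i ∪ Set.range j) : Set C) := by
  refine h.denseRange.mono ?_
  rintro _ ⟨t, rfl⟩
  induction t using TensorProduct.induction_on with
  | zero =>
    rw [map_zero]
    exact zero_mem _
  | tmul a d =>
    exact mul_mem (StarAlgebra.subset_adjoin ℂ _ (Or.inl ⟨a, rfl⟩))
      (StarAlgebra.subset_adjoin ℂ _ (Or.inr ⟨d, rfl⟩))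
  | add x y hx hy =>
    rw [map_add]
    exact add_mem hx hy

theorem hasCentralMatrixUnits_of_tensoriallyAbsorbs {D : Type*} [CStarAlgebra D]
    (hD : HasCentralMatrixUnits n D) (h : TensoriallyAbsorbs A D) : HasCentralMatrixUnits n A := by
  obtain ⟨C, _, i, j, hij, ⟨e⟩⟩ := h
  have hC : HasCentralMatrixUnits n C := by
    refine hasCentralMatrixUnits_of_dense_adjoin _ (dense_adjoin_range_union_range hij)
      fun F ε hF hε => hD.exists_of_map j F (fun x hx => (hF hx).symm.imp_right ?_) hε
    rintro ⟨a, rfl⟩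
    exact hij.commute a
  exact fun F ε hε => hC.exists_of_map (e : C →⋆ₐ[ℂ] A) F
    (fun x _ => Or.inl (e.surjective x)) hε

end Generators

/-! ### Cuntz families -/

/-- A finite family of isometries whose range projections add up to one, that is, a representation
of the relations of the Cuntz algebra `𝒪_n`. -/
structure IsCuntzFamily {B ι : Type*} [CStarAlgebra B] [Fintype ι] [DecidableEq ι]
    (s : ι → B) : Prop where
  star_mul_eq : ∀ i j, star (s i) * s j = if i = j then 1 else 0
  sum_mul_star : ∑ i, s i * star (s i) = 1

namespace IsCuntzFamily

variable {B ι : Type*} [CStarAlgebra B] [Fintype ι] [DecidableEq ι] {s : ι → B}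

theorem star_mul_mul (h : IsCuntzFamily s) (i j : ι) (x : B) :
    star (s i) * (s j * x) = if i = j then x else 0 := by
  rw [← mul_assoc, h.star_mul_eq, ite_mul, one_mul, zero_mul]

/-- The unital copy of the matrix algebra with matrix units `s_i s_j^*`. -/
noncomputable def matrixHom (h : IsCuntzFamily s) : Matrix ι ι ℂ →⋆ₐ[ℂ] B where
  toFun M := ∑ i, ∑ j, M i j • (s i * star (s j))
  map_one' := by simp [Matrix.one_apply, h.sum_mul_star]
  map_zero' := by simp
  map_add' M M' := by simp [add_smul, Finset.sum_add_distrib]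
  map_mul' M M' := by
    have mul_units (i j k l) : (M i j • (s i * star (s j))) * (M' k l • (s k * star (s l))) =
        if j = k then (M i j * M' k l) • (s i * star (s l)) else 0 := by
      rw [smul_mul_smul_comm, mul_assoc, h.star_mul_mul]
      split_ifs <;> simp
    simp only [Finset.sum_mul_sum, mul_units, Matrix.mul_apply, Finset.sum_smul]
    refine Finset.sum_congr rfl fun i _ => ?_
    rw [Finset.sum_comm]
    refine Finset.sum_congr rfl fun k _ => ?_
    rw [Finset.sum_comm]
    simp
  commutes' r := by
    simp [Matrix.algebraMap_matrix_apply, Algebra.algebraMap_eq_smul_one, ite_smul,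
      ← h.sum_mul_star, Finset.smul_sum]
  map_star' M := by
    rw [star_sum, Finset.sum_comm]
    simp [star_smul]

theorem matrixHom_apply (h : IsCuntzFamily s) (M : Matrix ι ι ℂ) :
    h.matrixHom M = ∑ i, ∑ j, M i j • (s i * star (s j)) := rfl

theorem matrixHom_single (h : IsCuntzFamily s) (i j : ι) :
    h.matrixHom (Matrix.single i j 1) = s i * star (s j) := by
  simp only [matrixHom_apply, Matrix.single_apply, ite_and, ite_smul, one_smul, zero_smul,
    Finset.sum_ite_irrel, Finset.sum_ite_eq, Finset.mem_univ, if_true, Finset.sum_const_zero]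

/-- The canonical endomorphism `x ↦ ∑ s_i x s_i^*`. -/
noncomputable def endo (h : IsCuntzFamily s) : B →⋆ₐ[ℂ] B where
  toFun x := ∑ i, s i * x * star (s i)
  map_one' := by simp [h.sum_mul_star]
  map_zero' := by simp
  map_add' x y := by simp [mul_add, add_mul, Finset.sum_add_distrib]
  map_mul' x y := by
    have mul_summands (i j) : s i * x * star (s i) * (s j * y * star (s j)) =
        if i = j then s i * (x * y) * star (s i) else 0 := by
      rw [mul_assoc _ (star (s i)), mul_assoc (s j), h.star_mul_mul]
      split_ifs with hij
      · simp only [hij, mul_assoc]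
      · rw [mul_zero]
    simp [Finset.sum_mul_sum, mul_summands]
  commutes' r := by
    simp [Algebra.algebraMap_eq_smul_one, ← Finset.smul_sum, h.sum_mul_star]
  map_star' x := by simp [star_sum, mul_assoc]

theorem endo_apply (h : IsCuntzFamily s) (x : B) : h.endo x = ∑ i, s i * x * star (s i) := rfl

theorem endo_mul (h : IsCuntzFamily s) (x : B) (i : ι) : h.endo x * s i = s i * x := by
  simp [endo_apply, Finset.sum_mul, mul_assoc, h.star_mul_eq]

theorem star_mul_endo (h : IsCuntzFamily s) (x : B) (i : ι) :
    star (s i) * h.endo x = x * star (s i) := by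
  simpa only [star_mul, map_star, star_star] using congrArg star (h.endo_mul (star x) i)

theorem commute_endo (h : IsCuntzFamily s) (x : B) (i j : ι) :
    Commute (s i * star (s j)) (h.endo x) := by
  rw [Commute, SemiconjBy, mul_assoc, h.star_mul_endo, ← mul_assoc, ← mul_assoc, h.endo_mul]

end IsCuntzFamily

/-! ### The universal UHF algebra -/

section BlockIsometry

theorem ellTwo_ext {E : Type*} [NormedAddCommGroup E] [NormedSpace ℂ E] {T T' : EllTwo →L[ℂ] E}
    (h : ∀ k, T (stdBasis k) = T' (stdBasis k)) : T = T' :=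
  ContinuousLinearMap.ext_on
    (Submodule.dense_iff_topologicalClosure_eq_top.mpr stdBasis.dense_span)
    (Set.forall_mem_range.mpr h)

theorem inner_stdBasis_blockIsometry {n : ℕ} {i j : Fin n} (hij : i ≠ j) (k : ℕ) (x : EllTwo) :
    inner ℂ (stdBasis (n * k + j)) (blockIsometry n i x) = 0 := by
  suffices (innerSL ℂ (stdBasis (n * k + j))).comp (blockIsometry n i) = 0 from
    DFunLike.congr_fun this x
  refine ellTwo_ext fun l => ?_
  rw [ContinuousLinearMap.comp_apply, blockIsometry_apply_stdBasis, innerSL_apply_apply]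
  refine stdBasis.orthonormal.2 fun hkl => hij (Fin.ext ?_)
  simpa only [Nat.mul_add_mod, Nat.mod_eq_of_lt i.2, Nat.mod_eq_of_lt j.2] using
    (congrArg (· % n) hkl).symm

theorem star_blockIsometry_mul (n : ℕ) (i j : Fin n) :
    star (blockIsometry n i) * blockIsometry n j = if i = j then 1 else 0 := by
  split_ifs with hij
  · subst hij
    exact (ContinuousLinearMap.norm_map_iff_adjoint_comp_self _).mp
      (orthonormal_stdBasis_mul_add i).orthogonalFamily.linearIsometry.norm_map
  · refine ellTwo_ext fun k => ext_inner_left ℂ fun x => ?_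
    rw [mul_apply_eq_comp, ContinuousLinearMap.star_eq_adjoint,
      ContinuousLinearMap.adjoint_inner_right, blockIsometry_apply_stdBasis, ← inner_conj_symm,
      inner_stdBasis_blockIsometry hij, map_zero, zero_apply, inner_zero_right]

theorem isCuntzFamily_blockIsometry (n : ℕ) [NeZero n] : IsCuntzFamily (blockIsometry n) where
  star_mul_eq := star_blockIsometry_mul n
  sum_mul_star := by
    refine ellTwo_ext fun k => ?_
    set j : Fin n := ⟨k % n, Nat.mod_lt k (NeZero.pos n)⟩
    have stdBasis_eq : stdBasis k = blockIsometry n j (stdBasis (k / n)) := by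
      rw [blockIsometry_apply_stdBasis]
      exact congrArg stdBasis (Nat.div_add_mod k n).symm
    rw [stdBasis_eq, ← mul_apply_eq_comp, ← mul_apply_eq_comp, one_mul]
    congr 1
    simp only [Finset.sum_mul, mul_assoc, star_blockIsometry_mul, mul_ite, mul_one, mul_zero,
      Finset.sum_ite_eq', Finset.mem_univ, if_true]

theorem blockIsometry_mul_blockIsometry (m k : ℕ) (i : Fin m) (j : Fin k) :
    blockIsometry m i * blockIsometry k j = blockIsometry (k * m) (finProdFinEquiv (j, i)) := by
  refine ellTwo_ext fun l => ?_
  simp only [mul_apply_eq_comp, blockIsometry_apply_stdBasis, finProdFinEquiv_apply_val]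
  exact congrArg stdBasis (by ring)

theorem endo_blockIsometry_mul (m k : ℕ) [NeZero m] [NeZero k] [NeZero (k * m)]
    (x : EllTwo →L[ℂ] EllTwo) : (isCuntzFamily_blockIsometry (k * m)).endo x =
      (isCuntzFamily_blockIsometry m).endo ((isCuntzFamily_blockIsometry k).endo x) := by
  simp only [IsCuntzFamily.endo_apply]
  rw [← Equiv.sum_comp finProdFinEquiv, Fintype.sum_prod_type_right]
  refine Finset.sum_congr rfl fun i _ => ?_
  simp only [Finset.mul_sum, Finset.sum_mul, ← blockIsometry_mul_blockIsometry, star_mul, mul_assoc]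

theorem commute_endo_blockIsometry {m N : ℕ} [NeZero N] (h : m ∣ N) (x : EllTwo →L[ℂ] EllTwo)
    (a b : Fin m) :
    Commute (blockIsometry m a * star (blockIsometry m b))
      ((isCuntzFamily_blockIsometry N).endo x) := by
  obtain ⟨k, rfl⟩ := exists_eq_mul_left_of_dvd h
  have : NeZero m := ⟨right_ne_zero_of_mul (NeZero.ne (k * m))⟩
  have : NeZero k := ⟨left_ne_zero_of_mul (NeZero.ne (k * m))⟩
  rw [endo_blockIsometry_mul]
  exact (isCuntzFamily_blockIsometry m).commute_endo _ a b

theorem endo_matrixHom_mem_universalUHF (n N : ℕ) [NeZero n] [NeZero N]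
    (M : Matrix (Fin n) (Fin n) ℂ) :
    (isCuntzFamily_blockIsometry N).endo ((isCuntzFamily_blockIsometry n).matrixHom M) ∈
      universalUHF := by
  simp only [IsCuntzFamily.matrixHom_apply, map_sum, map_smul]
  refine sum_mem fun i _ => sum_mem fun j _ => SMulMemClass.smul_mem _ ?_
  rw [IsCuntzFamily.endo_apply]
  refine sum_mem fun r _ => ?_
  rw [← mul_assoc, mul_assoc, ← star_mul, blockIsometry_mul_blockIsometry,
    blockIsometry_mul_blockIsometry]
  exact StarSubalgebra.le_topologicalClosure _ (StarAlgebra.subset_adjoin ℂ _ ⟨n * N, _, _, rfl⟩)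

/-- The copy of `M_n` obtained by amplifying `N`-fold commutes with `M_m` for every `m ∣ N`. -/
theorem hasCentralMatrixUnits_universalUHF (n : ℕ) [NeZero n] :
    HasCentralMatrixUnits n universalUHF := by
  classical
  refine hasCentralMatrixUnits_of_dense_adjoin _ (dense_adjoin_preimage_val _) fun F ε hF hε => ?_
  have exists_size (x : F) : ∃ (m : ℕ) (i j : Fin m),
      (x : EllTwo →L[ℂ] EllTwo) = blockIsometry m i * star (blockIsometry m j) := hF x.2
  choose size row col eq_unit using exists_size
  have : NeZero (∏ x, size x) := ⟨Finset.prod_ne_zero_iff.mpr fun x _ => (row x).pos.ne'⟩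
  set ψ := (isCuntzFamily_blockIsometry (∏ x, size x)).endo.comp
    (isCuntzFamily_blockIsometry n).matrixHom
  set χ := ψ.codRestrict universalUHF (endo_matrixHom_mem_universalUHF n _)
  refine ⟨χ, fun k l a ha => ?_⟩
  have commute : Commute (a : EllTwo →L[ℂ] EllTwo) (ψ (Matrix.single k l 1)) := by
    rw [eq_unit ⟨a, ha⟩]
    exact commute_endo_blockIsometry (Finset.dvd_prod_of_mem size (Finset.mem_univ _)) _ _ _
  have commutator_eq_zero : χ (Matrix.single k l 1) * a - a * χ (Matrix.single k l 1) = 0 :=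
    Subtype.ext (sub_eq_zero.mpr commute.eq.symm)
  rwa [commutator_eq_zero, norm_zero]

end BlockIsometry

/-! ### Unitaries with finite spectrum -/

section Path

variable {B : Type*} [CStarAlgebra B]

theorem finite_spectrum_of_isIntegral {R : Type*} [Ring R] [Algebra ℂ R] {x : R}
    (hx : IsIntegral ℂ x) : (spectrum ℂ x).Finite := by
  obtain ⟨p, hp, hpx : Polynomial.aeval x p = 0⟩ := hx
  refine (p.rootSet_finite ℂ).subset fun z hz => ?_
  have eval_mem := spectrum.subset_polynomial_aeval x p ⟨z, hz, rfl⟩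
  cases subsingleton_or_nontrivial R
  · simp only [spectrum.of_subsingleton, Set.mem_empty_iff_false] at hz
  rw [hpx, spectrum.zero_eq, Set.mem_singleton_iff] at eval_mem
  exact Polynomial.mem_rootSet.mpr ⟨hp.ne_zero, by simpa using eval_mem⟩

/-- The unit complex number of argument `t * arg z`. For `z` on the circle, this is the geodesic
from `1` to `z` at time `t`. -/
noncomputable def circlePath (t : ℝ) (z : ℂ) : ℂ :=
  Complex.exp (Complex.I * (t * Complex.arg z : ℝ))

theorem circlePath_zero (z : ℂ) : circlePath 0 z = 1 := by
  simp [circlePath]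

theorem circlePath_one {z : ℂ} (hz : ‖z‖ = 1) : circlePath 1 z = z := by
  simpa [circlePath, hz, mul_comm] using Complex.norm_mul_exp_arg_mul_I z

theorem norm_circlePath (t : ℝ) (z : ℂ) : ‖circlePath t z‖ = 1 := by
  rw [circlePath, mul_comm, Complex.norm_exp_ofReal_mul_I]

theorem norm_circlePath_sub_le (s t : ℝ) (z : ℂ) :
    ‖circlePath s z - circlePath t z‖ ≤ |s - t| * Real.pi := by
  have factor : circlePath s z - circlePath t z =
      circlePath t z * (Complex.exp (Complex.I * ((s - t) * Complex.arg z : ℝ)) - 1) := by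
    simp only [circlePath, mul_sub, mul_one, ← Complex.exp_add, ← mul_add, ← Complex.ofReal_add]
    ring_nf
  calc ‖circlePath s z - circlePath t z‖
      = ‖Complex.exp (Complex.I * ((s - t) * Complex.arg z : ℝ)) - 1‖ := by
        rw [factor, norm_mul, norm_circlePath, one_mul]
    _ ≤ |s - t| * |Complex.arg z| := by
        simpa [abs_mul] using
          Real.norm_exp_I_mul_ofReal_sub_one_le (x := (s - t) * Complex.arg z)
    _ ≤ |s - t| * Real.pi := by gcongr; exact Complex.abs_arg_le_pi z

theorem norm_eq_one_of_mem_spectrum_unitary {U : B} (hU : U ∈ unitary B) {z : ℂ}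
    (hz : z ∈ spectrum ℂ U) : ‖z‖ = 1 := by
  simpa using spectrum.subset_circle_of_unitary hU hz

/-- A unitary with finite spectrum is joined to `1` by `m` steps of size at most `π / m`; finiteness
makes the argument function continuous on the spectrum. -/
theorem exists_unitary_steps {U : B} (hU : U ∈ unitary B) (hfin : (spectrum ℂ U).Finite) {m : ℕ}
    (hm : m ≠ 0) :
    ∃ y : ℕ → B, y 0 = U ∧ y m = 1 ∧ (∀ j, y j ∈ unitary B) ∧
      (∀ j, ‖y j - y (j + 1)‖ ≤ Real.pi / m) ∧
      ∀ j x, Commute U x → Commute (star U) x → Commute (y j) x := by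
  have : IsStarNormal U := isStarNormal_of_mem_unitary hU
  have hm_real : (m : ℝ) ≠ 0 := Nat.cast_ne_zero.mpr hm
  have hcont (f : ℂ → ℂ) : ContinuousOn f (spectrum ℂ U) := hfin.continuousOn f
  refine ⟨fun j => cfc (circlePath (1 - j / m)) U, ?_, ?_, fun j => ?_, fun j => ?_,
    fun j x hx hx' => hx.cfc hx' _⟩
  · conv_rhs => rw [← cfc_id ℂ U]
    refine cfc_congr fun z hz => ?_
    simp only [Nat.cast_zero, zero_div, sub_zero, id,
      circlePath_one (norm_eq_one_of_mem_spectrum_unitary hU hz)]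
  · conv_rhs => rw [← cfc_const_one ℂ U]
    refine cfc_congr fun z _ => ?_
    simp only [div_self hm_real, sub_self, circlePath_zero]
  · rw [cfc_unitary_iff _ U (hf := hcont _)]
    intro z _
    rw [Complex.star_def, Complex.conj_mul', norm_circlePath, Complex.ofReal_one, one_pow]
  · rw [← cfc_sub _ _ _ (hcont _) (hcont _)]
    refine norm_cfc_le (by positivity) fun z _ => (norm_circlePath_sub_le _ _ z).trans_eq ?_
    have step_eq : (1 - j / m : ℝ) - (1 - (j + 1 : ℕ) / m) = 1 / m := by
      push_cast
      ring
    rw [step_eq, abs_of_nonneg (by positivity), one_div_mul_eq_div]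

end Path

/-! ### The eventual commutant of an endomorphism -/

section EventualCommutant

variable {B : Type*} [CStarAlgebra B] {σ : B →⋆ₐ[ℂ] B}

theorem commute_pow_apply_of_le {x : B} {K L : ℕ} (hx : ∀ y, Commute x ((σ ^ K) y)) (hKL : K ≤ L)
    (y : B) : Commute x ((σ ^ L) y) := by
  obtain ⟨M, rfl⟩ := Nat.exists_eq_add_of_le hKL
  rw [pow_add]
  exact hx _

/-- The *-subalgebra of the elements which commute with the range of some power of `σ`. -/
def eventualCommutant (σ : B →⋆ₐ[ℂ] B) : StarSubalgebra ℂ B where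
  carrier := {x | ∃ K, ∀ y, Commute x ((σ ^ K) y)}
  mul_mem' := by
    rintro a b ⟨K, ha⟩ ⟨L, hb⟩
    exact ⟨max K L, fun y => (commute_pow_apply_of_le ha (le_max_left K L) y).mul_left
      (commute_pow_apply_of_le hb (le_max_right K L) y)⟩
  add_mem' := by
    rintro a b ⟨K, ha⟩ ⟨L, hb⟩
    exact ⟨max K L, fun y => (commute_pow_apply_of_le ha (le_max_left K L) y).add_left
      (commute_pow_apply_of_le hb (le_max_right K L) y)⟩
  algebraMap_mem' c := ⟨0, fun y => Algebra.commutes c ((σ ^ 0) y)⟩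
  star_mem' := by
    rintro a ⟨K, ha⟩
    exact ⟨K, fun y => by rw [← star_star y, map_star]; exact (ha (star y)).star_star⟩

theorem mem_eventualCommutant {x : B} :
    x ∈ eventualCommutant σ ↔ ∃ K, ∀ y, Commute x ((σ ^ K) y) :=
  Iff.rfl

theorem mem_eventualCommutant_of_forall_commute {x : B} (hx : ∀ y, Commute x (σ y)) :
    x ∈ eventualCommutant σ :=
  ⟨1, fun y => by simpa using hx y⟩

theorem map_mem_eventualCommutant {x : B} (hx : x ∈ eventualCommutant σ) :
    σ x ∈ eventualCommutant σ := by
  obtain ⟨K, hK⟩ := hx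
  exact ⟨K + 1, fun y => by rw [pow_succ']; exact (hK y).map σ⟩

theorem map_pow_mem_eventualCommutant {x : B} (hx : x ∈ eventualCommutant σ) (j : ℕ) :
    (σ ^ j) x ∈ eventualCommutant σ := by
  induction j with
  | zero => exact hx
  | succ j ih => rw [pow_succ']; exact map_mem_eventualCommutant ih

theorem eventualCommutant_pow_le (q : ℕ) : eventualCommutant (σ ^ q) ≤ eventualCommutant σ := by
  rintro x ⟨K, hK⟩
  exact ⟨q * K, fun y => by rw [pow_mul]; exact hK y⟩

theorem exists_forall_commute_of_mem_eventualCommutant {ι : Type*} (s : Finset ι) {x : ι → B}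
    (hx : ∀ i ∈ s, x i ∈ eventualCommutant σ) :
    ∃ K, ∀ i ∈ s, ∀ y, Commute (x i) ((σ ^ K) y) := by
  choose! K hK using fun i hi => mem_eventualCommutant.mp (hx i hi)
  exact ⟨s.sup K, fun i hi => commute_pow_apply_of_le (hK i hi) (Finset.le_sup hi)⟩

end EventualCommutant

/-! ### Clifford families and almost flipped projections -/

section Clifford

variable {B : Type*} [CStarAlgebra B]

/-- Anticommuting self-adjoint unitaries. -/
structure IsCliffordFamily {ι : Type*} (c : ι → B) : Prop where
  isSelfAdjoint : ∀ i, IsSelfAdjoint (c i)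
  mul_self : ∀ i, c i * c i = 1
  mul_comm_neg : ∀ i j, i ≠ j → c i * c j = -(c j * c i)

namespace IsCliffordFamily

variable {ι : Type*} {c : ι → B}

theorem norm_eq_one [Nontrivial B] (hc : IsCliffordFamily c) (i : ι) : ‖c i‖ = 1 := by
  refine CStarRing.norm_of_mem_unitary (Unitary.mem_iff.mpr ?_)
  rw [(hc.isSelfAdjoint i).star_eq, and_self, hc.mul_self i]

theorem anticommutator [DecidableEq ι] (hc : IsCliffordFamily c) (i j : ι) :
    c i * c j + c j * c i = if i = j then (2 : ℂ) • (1 : B) else 0 := by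
  split_ifs with hij
  · rw [hij, hc.mul_self, two_smul]
  · rw [hc.mul_comm_neg i j hij, neg_add_cancel]

theorem anticommutator_sum_smul (hc : IsCliffordFamily c) (a b : ι → ℂ) (s : Finset ι) :
    (∑ i ∈ s, a i • c i) * (∑ j ∈ s, b j • c j) + (∑ j ∈ s, b j • c j) * (∑ i ∈ s, a i • c i) =
      (2 * ∑ i ∈ s, a i * b i) • 1 := by
  classical
  calc (∑ i ∈ s, a i • c i) * (∑ j ∈ s, b j • c j) + (∑ j ∈ s, b j • c j) * (∑ i ∈ s, a i • c i)
      = ∑ i ∈ s, ∑ j ∈ s, (a i * b j) • (c i * c j + c j * c i) := by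
        simp only [Finset.sum_mul_sum, smul_mul_smul_comm, smul_add, Finset.sum_add_distrib]
        rw [Finset.sum_comm (f := fun j i => (b j * a i) • (c j * c i))]
        simp only [mul_comm (b _)]
    _ = ∑ i ∈ s, (2 * (a i * b i)) • 1 := by
        refine Finset.sum_congr rfl fun i hi => ?_
        simp only [hc.anticommutator, smul_ite, smul_zero, Finset.sum_ite_eq, hi, if_true,
          smul_smul, mul_comm]
    _ = (2 * ∑ i ∈ s, a i * b i) • 1 := by rw [← Finset.sum_smul, Finset.mul_sum]

theorem sum_smul_mul_self (hc : IsCliffordFamily c) (a : ι → ℂ) (s : Finset ι) :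
    (∑ i ∈ s, a i • c i) * (∑ i ∈ s, a i • c i) = (∑ i ∈ s, a i * a i) • 1 := by
  refine smul_right_injective B (two_ne_zero (α := ℂ)) ?_
  simp only [two_smul ℂ (_ * _), hc.anticommutator_sum_smul, smul_smul]

end IsCliffordFamily

theorem isStarProjection_half_smul_one_add {V : B} (hV : IsSelfAdjoint V) (hVV : V * V = 1) :
    IsStarProjection ((2 : ℂ)⁻¹ • (1 + V)) where
  isIdempotentElem := by
    rw [IsIdempotentElem, smul_mul_smul_comm, mul_add, add_mul, add_mul, hVV, one_mul, one_mul,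
      mul_one, add_comm V 1, ← two_smul ℂ (1 + V), smul_smul]
    norm_num
  isSelfAdjoint := IsSelfAdjoint.smul (by simp [IsSelfAdjoint]) ((IsSelfAdjoint.one B).add hV)

/-- The sum of the first `K` members of `c` with the geometric weights `z ^ i`. -/
noncomputable def geometricSum (c : ℕ → B) (z : ℂ) (K : ℕ) : B :=
  ∑ i ∈ Finset.range K, z ^ i • c i

/-- The spectral projection of the self-adjoint unitary `(I / K) x y`, where `x = ∑ c i` and
`y = ∑ (-1) ^ i c i`. An endomorphism shifting `c` almost fixes `x` and almost negates `y`. -/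
noncomputable def flippedProjection (c : ℕ → B) (K : ℕ) : B :=
  (2 : ℂ)⁻¹ • (1 + (Complex.I / K) • (geometricSum c 1 K * geometricSum c (-1) K))

theorem flippedProjection_mem {c : ℕ → B} {S : StarSubalgebra ℂ B} (hc : ∀ i, c i ∈ S) (K : ℕ) :
    flippedProjection c K ∈ S := by
  have sum_mem_S (z : ℂ) : geometricSum c z K ∈ S :=
    sum_mem fun i _ => SMulMemClass.smul_mem _ (hc i)
  exact SMulMemClass.smul_mem _ (add_mem (one_mem S)
    (SMulMemClass.smul_mem _ (mul_mem (sum_mem_S _) (sum_mem_S _))))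

theorem sum_range_pow_smul_succ (c : ℕ → B) {z : ℂ} (hz : z * z = 1) {K : ℕ} (hK : Even K) :
    ∑ i ∈ Finset.range K, z ^ i • c (i + 1) = z • (geometricSum c z K + (c K - c 0)) := by
  have pow_eq_one : z ^ K = 1 := by
    obtain ⟨r, rfl⟩ := hK
    rw [pow_add, ← mul_pow, hz, one_pow]
  have shift : z • ∑ i ∈ Finset.range K, z ^ i • c (i + 1) + c 0 = geometricSum c z K + c K := by
    have := Finset.sum_range_succ' (fun i => z ^ i • c i) K
    rw [Finset.sum_range_succ, pow_eq_one, pow_zero, one_smul, one_smul] at this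
    rw [geometricSum, this, Finset.smul_sum]
    simp only [smul_smul, pow_succ']
  rw [← add_sub_assoc, ← shift, add_sub_cancel_right, smul_smul, hz, one_smul]

theorem map_geometricSum_mul {c : ℕ → B} {σ : B →⋆ₐ[ℂ] B}
    (hσ : ∀ i j, σ (c i * c j) = c (i + 1) * c (j + 1)) {z w : ℂ} (hz : z * z = 1)
    (hw : w * w = 1) {K : ℕ} (hK : Even K) :
    σ (geometricSum c z K * geometricSum c w K) =
      (z * w) • ((geometricSum c z K + (c K - c 0)) * (geometricSum c w K + (c K - c 0))) := by
  rw [← smul_mul_smul_comm, ← sum_range_pow_smul_succ c hz hK, ← sum_range_pow_smul_succ c hw hK]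
  simp only [geometricSum, Finset.sum_mul_sum, smul_mul_smul_comm, map_sum, map_smul, hσ]

theorem map_flippedProjection_sub {c : ℕ → B} {σ : B →⋆ₐ[ℂ] B}
    (hσ : ∀ i j, σ (c i * c j) = c (i + 1) * c (j + 1)) {K : ℕ} (hK : Even K) :
    σ (flippedProjection c K) - (1 - flippedProjection c K) =
      (-((2 : ℂ)⁻¹ * (Complex.I / K))) • (geometricSum c 1 K * (c K - c 0) +
        (c K - c 0) * geometricSum c (-1) K + (c K - c 0) * (c K - c 0)) := by
  have one_eq : (1 : B) = (2 : ℂ)⁻¹ • 1 + (2 : ℂ)⁻¹ • 1 := by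
    rw [← add_smul]
    norm_num
  simp only [flippedProjection, map_smul, map_add, map_one,
    map_geometricSum_mul hσ (one_mul 1) (w := -1) (by norm_num) hK]
  conv_lhs => enter [2, 1]; rw [one_eq]
  generalize geometricSum c (-1) K = y
  simp only [smul_add, smul_smul, mul_add, add_mul, mul_neg, mul_one, neg_smul,
    smul_neg, one_smul]
  abel

namespace IsCliffordFamily

variable {c : ℕ → B} {σ : B →⋆ₐ[ℂ] B} {K : ℕ}

theorem isSelfAdjoint_geometricSum (hc : IsCliffordFamily c) {z : ℂ} (hz : IsSelfAdjoint z) :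
    IsSelfAdjoint (geometricSum c z K) :=
  isSelfAdjoint_sum _ fun i _ => (hz.pow i).smul (hc.isSelfAdjoint i)

theorem geometricSum_mul_self (hc : IsCliffordFamily c) {z : ℂ} (hz : z * z = 1) :
    geometricSum c z K * geometricSum c z K = (K : ℂ) • 1 := by
  rw [geometricSum, hc.sum_smul_mul_self]
  simp only [← mul_pow, hz, one_pow, Finset.sum_const, Finset.card_range, nsmul_eq_mul, mul_one]

theorem geometricSum_mul_comm_neg (hc : IsCliffordFamily c) (hK : Even K) :
    geometricSum c (-1) K * geometricSum c 1 K =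
      -(geometricSum c 1 K * geometricSum c (-1) K) := by
  have alternating_sum : ∑ i ∈ Finset.range K, (1 : ℂ) ^ i * (-1) ^ i = 0 := by
    simp only [one_pow, one_mul, neg_one_geom_sum, if_pos hK]
  have anticommutator_eq := hc.anticommutator_sum_smul (1 ^ ·) ((-1) ^ ·) (Finset.range K)
  rw [alternating_sum, mul_zero, zero_smul, add_comm] at anticommutator_eq
  exact eq_neg_of_add_eq_zero_left anticommutator_eq

theorem norm_geometricSum [Nontrivial B] (hc : IsCliffordFamily c) {z : ℂ}
    (hz : IsSelfAdjoint z) (hzz : z * z = 1) : ‖geometricSum c z K‖ = √K := by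
  rw [eq_comm, Real.sqrt_eq_iff_mul_self_eq (by positivity) (norm_nonneg _),
    ← CStarRing.norm_star_mul_self, (hc.isSelfAdjoint_geometricSum hz).star_eq,
    hc.geometricSum_mul_self hzz, norm_smul, norm_one, mul_one, Complex.norm_natCast]

theorem isStarProjection_flippedProjection (hc : IsCliffordFamily c) (hK : Even K) (hK0 : K ≠ 0) :
    IsStarProjection (flippedProjection c K) := by
  have hx := hc.geometricSum_mul_self (K := K) (one_mul 1)
  have hy := hc.geometricSum_mul_self (K := K) (z := -1) (by norm_num)
  have hyx := hc.geometricSum_mul_comm_neg hK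
  rw [flippedProjection]
  set x := geometricSum c 1 K
  set y := geometricSum c (-1) K
  have mul_mul_self : x * y * (x * y) = -((K : ℂ) * K) • (1 : B) := calc
    x * y * (x * y) = x * (y * x) * y := by simp only [mul_assoc]
    _ = -(x * x * (y * y)) := by rw [hyx]; simp only [mul_neg, neg_mul, mul_assoc]
    _ = -((K : ℂ) * K) • (1 : B) := by rw [hx, hy, smul_mul_smul_comm, mul_one, neg_smul]
  have scalar_eq_one : Complex.I / K * (Complex.I / K) * -((K : ℂ) * K) = 1 := by
    have hKc : (K : ℂ) ≠ 0 := Nat.cast_ne_zero.mpr hK0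
    field_simp
    simp
  refine isStarProjection_half_smul_one_add ?_ ?_
  · rw [IsSelfAdjoint, star_smul, star_mul,
      (hc.isSelfAdjoint_geometricSum (IsSelfAdjoint.one ℂ)).star_eq,
      (hc.isSelfAdjoint_geometricSum (IsSelfAdjoint.one ℂ).neg).star_eq, hyx]
    simp [neg_div]
  · rw [smul_mul_smul_comm, mul_mul_self, smul_smul, scalar_eq_one, one_smul]

theorem norm_map_flippedProjection_sub_le [Nontrivial B] (hc : IsCliffordFamily c)
    (hσ : ∀ i j, σ (c i * c j) = c (i + 1) * c (j + 1)) (hK : Even K) (hK0 : K ≠ 0) :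
    ‖σ (flippedProjection c K) - (1 - flippedProjection c K)‖ ≤ 4 / √K := by
  have hK_real : 1 ≤ √(K : ℝ) := by
    rw [Real.one_le_sqrt]
    exact_mod_cast Nat.one_le_iff_ne_zero.mpr hK0
  rw [map_flippedProjection_sub hσ hK]
  have norm_x : ‖geometricSum c 1 K‖ = √K := hc.norm_geometricSum (IsSelfAdjoint.one ℂ) (one_mul 1)
  have norm_y : ‖geometricSum c (-1) K‖ = √K :=
    hc.norm_geometricSum (IsSelfAdjoint.one ℂ).neg (by norm_num)
  set x := geometricSum c 1 K
  set y := geometricSum c (-1) K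
  set d := c K - c 0
  have norm_d : ‖d‖ ≤ 2 := by
    refine (norm_sub_le _ _).trans ?_
    rw [hc.norm_eq_one, hc.norm_eq_one]
    norm_num
  have norm_scalar : ‖-((2 : ℂ)⁻¹ * (Complex.I / K))‖ = 1 / (2 * K) := by
    rw [norm_neg, norm_mul, norm_inv, norm_div, Complex.norm_I, Complex.norm_natCast,
      Complex.norm_ofNat]
    ring
  calc ‖(-((2 : ℂ)⁻¹ * (Complex.I / K))) • (x * d + d * y + d * d)‖
      ≤ 1 / (2 * K) * (‖x‖ * ‖d‖ + ‖d‖ * ‖y‖ + ‖d‖ * ‖d‖) := by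
        rw [norm_smul, norm_scalar]
        gcongr
        exact norm_add₃_le.trans (add_le_add_three (norm_mul_le _ _) (norm_mul_le _ _)
          (norm_mul_le _ _))
    _ ≤ 1 / (2 * K) * (√K * 2 + 2 * √K + 2 * 2) := by rw [norm_x, norm_y]; gcongr
    _ ≤ 1 / (2 * (√K * √K)) * (8 * √K) := by
        rw [Real.mul_self_sqrt (Nat.cast_nonneg K)]
        gcongr
        linarith
    _ = 4 / √K := by field_simp; norm_num

end IsCliffordFamily

/-- The Jordan–Wigner sequence `X, Z σ(X), Z σ(Z) σ²(X), …` of an endomorphism `σ` and two elements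
`X`, `Z`. -/
def jordanWigner (σ : B →⋆ₐ[ℂ] B) (X Z : B) : ℕ → B
  | 0 => X
  | j + 1 => Z * σ (jordanWigner σ X Z j)

variable {σ : B →⋆ₐ[ℂ] B} {X Z : B}

theorem map_jordanWigner_mul (hZ : Z * Z = 1) (hσ : ∀ y, Commute Z (σ y)) (i j : ℕ) :
    σ (jordanWigner σ X Z i * jordanWigner σ X Z j) =
      jordanWigner σ X Z (i + 1) * jordanWigner σ X Z (j + 1) := by
  simp only [jordanWigner]
  rw [map_mul, (hσ _).eq, mul_assoc, ← mul_assoc Z, hZ, one_mul]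

theorem jordanWigner_mul_comm_neg_of_lt (hZ : Z * Z = 1) (hXZ : X * Z = -(Z * X))
    (hσX : ∀ y, Commute X (σ y)) (hσZ : ∀ y, Commute Z (σ y)) {i j : ℕ} (hij : i < j) :
    jordanWigner σ X Z i * jordanWigner σ X Z j =
      -(jordanWigner σ X Z j * jordanWigner σ X Z i) := by
  induction i generalizing j with
  | zero =>
    obtain ⟨j, rfl⟩ := Nat.exists_eq_succ_of_ne_zero hij.ne'
    simp only [jordanWigner]
    rw [← mul_assoc, hXZ, neg_mul, mul_assoc, (hσX _).eq, ← mul_assoc]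
  | succ i ih =>
    obtain ⟨j, rfl⟩ := Nat.exists_eq_succ_of_ne_zero (Nat.ne_zero_of_lt hij)
    rw [Nat.succ_eq_add_one, ← map_jordanWigner_mul hZ hσZ, ← map_jordanWigner_mul hZ hσZ,
      ih (Nat.lt_of_succ_lt_succ hij), map_neg]

theorem isCliffordFamily_jordanWigner (hX : IsSelfAdjoint X) (hXX : X * X = 1)
    (hZ : IsSelfAdjoint Z) (hZZ : Z * Z = 1) (hXZ : X * Z = -(Z * X))
    (hσX : ∀ y, Commute X (σ y)) (hσZ : ∀ y, Commute Z (σ y)) :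
    IsCliffordFamily (jordanWigner σ X Z) where
  isSelfAdjoint j := by
    induction j with
    | zero => exact hX
    | succ j ih =>
      rw [jordanWigner, IsSelfAdjoint, star_mul, hZ.star_eq, ← map_star, ih.star_eq, (hσZ _).eq]
  mul_self j := by
    induction j with
    | zero => exact hXX
    | succ j ih => rw [← map_jordanWigner_mul hZZ hσZ, ih, map_one]
  mul_comm_neg i j hij := by
    rcases lt_or_gt_of_ne hij with hij | hij
    · exact jordanWigner_mul_comm_neg_of_lt hZZ hXZ hσX hσZ hij
    · rw [jordanWigner_mul_comm_neg_of_lt hZZ hXZ hσX hσZ hij, neg_neg]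

theorem jordanWigner_mem_eventualCommutant (hσX : ∀ y, Commute X (σ y))
    (hσZ : ∀ y, Commute Z (σ y)) (j : ℕ) : jordanWigner σ X Z j ∈ eventualCommutant σ := by
  induction j with
  | zero => exact mem_eventualCommutant_of_forall_commute hσX
  | succ j ih =>
    exact mul_mem (mem_eventualCommutant_of_forall_commute hσZ) (map_mem_eventualCommutant ih)

theorem exists_flipped_projection [Nontrivial B] (hX : IsSelfAdjoint X) (hXX : X * X = 1)
    (hZ : IsSelfAdjoint Z) (hZZ : Z * Z = 1) (hXZ : X * Z = -(Z * X))
    (hσX : ∀ y, Commute X (σ y)) (hσZ : ∀ y, Commute Z (σ y)) {ε : ℝ} (hε : 0 < ε) :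
    ∃ p ∈ eventualCommutant σ, IsStarProjection p ∧ ‖σ p - (1 - p)‖ < ε := by
  have hc := isCliffordFamily_jordanWigner hX hXX hZ hZZ hXZ hσX hσZ
  obtain ⟨r, hr⟩ := exists_nat_gt ((4 / ε) ^ 2)
  have hr0 : (0 : ℝ) < r := (sq_nonneg _).trans_lt hr
  have hK0 : 2 * r ≠ 0 := mul_ne_zero two_ne_zero (Nat.cast_pos.mp hr0).ne'
  have sqrt_gt : 4 / ε < √(2 * r : ℕ) := Real.lt_sqrt_of_sq_lt (by push_cast; linarith)
  refine ⟨flippedProjection (jordanWigner σ X Z) (2 * r),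
    flippedProjection_mem (jordanWigner_mem_eventualCommutant hσX hσZ) _,
    hc.isStarProjection_flippedProjection (even_two_mul r) hK0,
    (hc.norm_map_flippedProjection_sub_le (map_jordanWigner_mul hZZ hσZ) (even_two_mul r)
      hK0).trans_lt ?_⟩
  rwa [div_lt_comm₀ ((by positivity : 0 < 4 / ε).trans sqrt_gt) hε]

end Clifford

/-! ### Rokhlin towers -/

section Tower

variable {B : Type*} [CStarAlgebra B]

theorem completeOrthogonalIdempotents_of_sum_eq_one {ι : Type*} [Fintype ι] {p : ι → B}
    (hp : ∀ i, IsStarProjection (p i)) (hsum : ∑ i, p i = 1) : CompleteOrthogonalIdempotents p where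
  idem i := (hp i).isIdempotentElem
  ortho i j hij := by
    classical
    let _ := CStarAlgebra.spectralOrder B
    have := CStarAlgebra.spectralOrderedRing B
    have le_one_sub : p i ≤ 1 - p j := by
      rw [← hsum, ← Finset.sum_erase_eq_sub (Finset.mem_univ j)]
      exact Finset.single_le_sum (f := p) (fun k _ => (hp k).nonneg)
        (Finset.mem_erase.mpr ⟨hij, Finset.mem_univ i⟩)
    rw [(hp i).le_iff_mul_eq_left (hp j).one_sub, mul_sub, mul_one] at le_one_sub
    exact sub_eq_self.mp le_one_sub
  complete := hsum

/-- A Rokhlin tower of height `m` for `σ`: projections `e 0, …, e (m - 1)` with sum one, extended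
periodically to `ℕ`, which `σ` permutes cyclically up to `ε`. -/
structure IsRokhlinTower (σ : B →⋆ₐ[ℂ] B) (m : ℕ) (ε : ℝ) (e : ℕ → B) : Prop where
  isStarProjection : ∀ j, IsStarProjection (e j)
  periodic : Function.Periodic e m
  sum_eq_one : ∑ j ∈ Finset.range m, e j = 1
  norm_map_sub_lt : ∀ j, ‖σ (e j) - e (j + 1)‖ < ε

variable {σ : B →⋆ₐ[ℂ] B} {m : ℕ}

theorem pow_apply_comm (i j : ℕ) (x : B) : (σ ^ i) ((σ ^ j) x) = (σ ^ j) ((σ ^ i) x) :=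
  DFunLike.congr_fun (pow_mul_comm σ i j) x

theorem IsRokhlinTower.map_pow {ε : ℝ} {e : ℕ → B} (he : IsRokhlinTower σ m ε e) (M : ℕ) :
    IsRokhlinTower σ m ε fun j => (σ ^ M) (e j) where
  isStarProjection j := (he.isStarProjection j).map (σ ^ M)
  periodic := he.periodic.comp (σ ^ M)
  sum_eq_one := by rw [← map_sum, he.sum_eq_one, map_one]
  norm_map_sub_lt j := by
    have map_comm := pow_apply_comm (σ := σ) 1 M (e j)
    rw [pow_one] at map_comm
    rw [map_comm, ← map_sub]
    exact (NonUnitalStarAlgHom.norm_apply_le (σ ^ M) _).trans_lt (he.norm_map_sub_lt j)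

/-- The orbit of `p` under `σ`, restarted every `m` steps and with `p` alternately replaced by
`1 - p`. It is almost an orbit if `σ ^ m` almost exchanges `p` and `1 - p`. -/
def alternatingOrbit (σ : B →⋆ₐ[ℂ] B) (m : ℕ) (p : B) (j : ℕ) : B :=
  if Even (j / m) then (σ ^ (j % m)) p else 1 - (σ ^ (j % m)) p

theorem alternatingOrbit_add (hm : 0 < m) (p : B) (j : ℕ) :
    alternatingOrbit σ m p (j + m) = 1 - alternatingOrbit σ m p j := by
  simp only [alternatingOrbit, Nat.add_div_right _ hm, Nat.add_mod_right, Nat.even_add_one, ite_not]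
  split_ifs
  · rfl
  · rw [sub_sub_cancel]

theorem alternatingOrbit_of_lt (p : B) {j : ℕ} (hj : j < m) :
    alternatingOrbit σ m p j = (σ ^ j) p := by
  rw [alternatingOrbit, Nat.div_eq_of_lt hj, Nat.mod_eq_of_lt hj, if_pos Even.zero]

theorem isStarProjection_alternatingOrbit {p : B} (hp : IsStarProjection p) (j : ℕ) :
    IsStarProjection (alternatingOrbit σ m p j) := by
  rw [alternatingOrbit]
  split_ifs
  exacts [hp.map _, (hp.map _).one_sub]

theorem commute_alternatingOrbit {p b : B} (hb : ∀ j, Commute b ((σ ^ j) p)) (j : ℕ) :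
    Commute b (alternatingOrbit σ m p j) := by
  rw [alternatingOrbit]
  split_ifs
  exacts [hb _, (Commute.one_right b).sub_right (hb _)]

theorem alternatingOrbit_mem_eventualCommutant {p : B} (hp : p ∈ eventualCommutant σ) (j : ℕ) :
    alternatingOrbit σ m p j ∈ eventualCommutant σ := by
  rw [alternatingOrbit]
  split_ifs
  exacts [map_pow_mem_eventualCommutant hp _,
    sub_mem (one_mem _) (map_pow_mem_eventualCommutant hp _)]

theorem norm_map_alternatingOrbit_sub_le (hm : 0 < m) (p : B) (j : ℕ) :
    ‖σ (alternatingOrbit σ m p j) - alternatingOrbit σ m p (j + 1)‖ ≤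
      ‖(σ ^ m) p - (1 - p)‖ := by
  have periodic : Function.Periodic
      (fun j => ‖σ (alternatingOrbit σ m p j) - alternatingOrbit σ m p (j + 1)‖) m := fun j => by
    dsimp only
    rw [add_right_comm, alternatingOrbit_add hm, alternatingOrbit_add hm, map_sub, map_one,
      sub_sub_sub_cancel_left, norm_sub_rev]
  rw [← periodic.map_mod_nat j]
  have hj := Nat.mod_lt j hm
  have map_eq : σ (alternatingOrbit σ m p (j % m)) = (σ ^ (j % m + 1)) p := by
    rw [alternatingOrbit_of_lt p hj, pow_succ']
    rfl
  rw [map_eq]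
  rcases (Nat.succ_le_of_lt hj).lt_or_eq with hj | hj
  · rw [alternatingOrbit_of_lt p hj, sub_self, norm_zero]
    exact norm_nonneg _
  · have wrap := alternatingOrbit_add (σ := σ) hm p 0
    rw [zero_add, alternatingOrbit_of_lt p hm, pow_zero] at wrap
    rw [← Nat.succ_eq_add_one, hj, wrap]
    rfl

theorem IsRokhlinTower.mul_alternatingOrbit {ε δ : ℝ} {e : ℕ → B} {p : B}
    (he : IsRokhlinTower σ m ε e) (hm : 0 < m) (hp : IsStarProjection p)
    (hflip : ‖(σ ^ m) p - (1 - p)‖ < δ) (hcomm : ∀ i j, Commute (e i) ((σ ^ j) p)) :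
    IsRokhlinTower σ (m + m) (ε + δ) fun j => e j * alternatingOrbit σ m p j where
  isStarProjection j := (he.isStarProjection j).mul (isStarProjection_alternatingOrbit hp j)
    (commute_alternatingOrbit (hcomm j) j)
  periodic j := by
    dsimp only
    rw [← add_assoc, he.periodic, he.periodic, alternatingOrbit_add hm, alternatingOrbit_add hm,
      sub_sub_cancel]
  sum_eq_one := by
    rw [Finset.sum_range_add, ← Finset.sum_add_distrib, ← he.sum_eq_one]
    refine Finset.sum_congr rfl fun j _ => ?_
    rw [add_comm m j, he.periodic, alternatingOrbit_add hm, ← mul_add, add_sub_cancel, mul_one]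
  norm_map_sub_lt j := by
    have telescope : σ (e j * alternatingOrbit σ m p j) -
        e (j + 1) * alternatingOrbit σ m p (j + 1) =
        σ (e j) * (σ (alternatingOrbit σ m p j) - alternatingOrbit σ m p (j + 1)) +
          (σ (e j) - e (j + 1)) * alternatingOrbit σ m p (j + 1) := by
      rw [map_mul, mul_sub, sub_mul, sub_add_sub_cancel]
    rw [telescope, add_comm ε]
    refine (norm_add_le _ _).trans_lt (add_lt_add ?_ ?_)
    · exact (norm_mul_le_of_norm_le_one_left ((he.isStarProjection j).map σ).norm_le _).trans_lt
        ((norm_map_alternatingOrbit_sub_le hm p j).trans_lt hflip)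
    · exact (norm_mul_le_of_norm_le_one_right
        (isStarProjection_alternatingOrbit hp (j + 1)).norm_le _).trans_lt (he.norm_map_sub_lt j)

/-- A tower of height `m` is cut in two by a projection which `σ ^ m` almost flips. Applying a high
power of `σ` first makes that projection commute with the given tower. -/
theorem exists_isRokhlinTower_two_pow
    (hflip : ∀ q ≠ 0, ∀ ε > 0, ∃ p ∈ eventualCommutant σ,
      IsStarProjection p ∧ ‖(σ ^ q) p - (1 - p)‖ < ε) (k : ℕ) {ε : ℝ} (hε : 0 < ε) :
    ∃ e : ℕ → B, IsRokhlinTower σ (2 ^ k) ε e ∧ ∀ j, e j ∈ eventualCommutant σ := by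
  induction k generalizing ε with
  | zero =>
    refine ⟨fun _ => 1, ⟨fun _ => IsStarProjection.one B, fun _ => rfl, ?_, fun _ => ?_⟩,
      fun _ => one_mem _⟩
    · rw [pow_zero, Finset.sum_range_one]
    · rwa [map_one, sub_self, norm_zero]
  | succ k ih =>
    obtain ⟨e, he, he_mem⟩ := ih (half_pos hε)
    obtain ⟨p, hp_mem, hp, hpflip⟩ := hflip (2 ^ k) (by positivity) (ε / 2) (half_pos hε)
    obtain ⟨K, hK⟩ := exists_forall_commute_of_mem_eventualCommutant
      (Finset.range (2 ^ k)) fun j _ => he_mem j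
    have commute_tower (i j : ℕ) : Commute (e i) ((σ ^ j) ((σ ^ K) p)) := by
      rw [pow_apply_comm, ← he.periodic.map_mod_nat i]
      exact hK _ (Finset.mem_range.mpr (Nat.mod_lt _ (by positivity))) _
    have flip_map : ‖(σ ^ 2 ^ k) ((σ ^ K) p) - (1 - (σ ^ K) p)‖ < ε / 2 := by
      rw [pow_apply_comm, ← map_one (σ ^ K), ← map_sub, ← map_sub]
      exact (NonUnitalStarAlgHom.norm_apply_le (σ ^ K) _).trans_lt hpflip
    rw [pow_succ, mul_two, ← add_halves ε]
    exact ⟨_, he.mul_alternatingOrbit (by positivity) (hp.map (σ ^ K)) flip_map commute_tower,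
      fun j => mul_mem (he_mem j)
        (alternatingOrbit_mem_eventualCommutant (map_pow_mem_eventualCommutant hp_mem K) j)⟩

end Tower

/-! ### Almost coboundaries -/

section Coboundary

variable {B : Type*} [CStarAlgebra B]

theorem sum_mul_mul_sum_mul {R ι : Type*} [Semiring R] [Fintype ι] {E : ι → R}
    (hE : OrthogonalIdempotents E) (a : ι → R) {b : ι → R} (hb : ∀ i j, Commute (b i) (E j)) :
    (∑ i, a i * E i) * ∑ i, b i * E i = ∑ i, a i * b i * E i := by
  classical
  rw [Finset.sum_mul_sum]
  refine Finset.sum_congr rfl fun i _ => ?_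
  simp only [(hb _ _).eq, mul_assoc]
  simp only [← mul_assoc (E i), hE.mul_eq, ite_mul, zero_mul, mul_ite, mul_zero,
    Finset.sum_ite_eq, Finset.mem_univ, if_true]

theorem sum_mul_mem_unitary {ι : Type*} [Fintype ι] {E a : ι → B}
    (hE : CompleteOrthogonalIdempotents E) (hE_star : ∀ i, IsSelfAdjoint (E i))
    (ha : ∀ i, a i ∈ unitary B) (hcomm : ∀ i j, Commute (a i) (E j)) :
    ∑ i, a i * E i ∈ unitary B := by
  have star_comm (i j) : Commute (star (a i)) (E j) := by
    rw [← (hE_star j).star_eq]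
    exact (hcomm i j).star_star
  have star_sum_eq : star (∑ i, a i * E i) = ∑ i, star (a i) * E i := by
    simp only [star_sum, star_mul, (hE_star _).star_eq, (star_comm _ _).eq]
  rw [Unitary.mem_iff, star_sum_eq, sum_mul_mul_sum_mul hE.toOrthogonalIdempotents _ hcomm,
    sum_mul_mul_sum_mul hE.toOrthogonalIdempotents _ star_comm]
  simp only [Unitary.star_mul_self_of_mem (ha _), Unitary.mul_star_self_of_mem (ha _), one_mul,
    hE.complete, and_self]

theorem norm_sum_mul_le_of_commute [Nontrivial B] {ι : Type*} [Fintype ι] {E x : ι → B}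
    (hE : CompleteOrthogonalIdempotents E) (hE_star : ∀ i, IsSelfAdjoint (E i))
    (hcomm : ∀ i, Commute (x i) (E i)) {η : ℝ} (hη : 0 ≤ η) (hx : ∀ i, ‖x i‖ ≤ η) :
    ‖∑ i, x i * E i‖ ≤ η := by
  have sandwich (i) : x i * E i = star (E i) * x i * E i := by
    rw [(hE_star i).star_eq, ← (hcomm i).eq, mul_assoc, (hE.idem i).eq]
  have star_mul_self (i) : star (E i) * E i = E i := by
    rw [(hE_star i).star_eq, (hE.idem i).eq]
  simp only [sandwich]
  refine (norm_sum_star_mul_mul_le E x E (t := fun _ => η ^ 2) fun i => by gcongr; exact hx i).trans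
    (le_of_eq ?_)
  simp only [star_mul_self, ← Finset.smul_sum, hE.complete, norm_one, Real.sqrt_one, one_mul,
    norm_smul, mul_one]
  rw [Real.norm_of_nonneg (sq_nonneg η), Real.sqrt_sq hη]

theorem sum_range_eq_sum_range_succ {M : Type*} [AddCommGroup M] {x : ℕ → M} {m : ℕ}
    (hx : x m = x 0) : ∑ j ∈ Finset.range m, x j = ∑ j ∈ Finset.range m, x (j + 1) := by
  have := Finset.sum_range_succ' x m
  rw [Finset.sum_range_succ, hx] at this
  exact add_right_cancel this

namespace IsRokhlinTower

variable {σ : B →⋆ₐ[ℂ] B} {m : ℕ} {δ : ℝ} {e : ℕ → B}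

theorem completeOrthogonalIdempotents (he : IsRokhlinTower σ m δ e) :
    CompleteOrthogonalIdempotents fun j : Fin m => e j :=
  completeOrthogonalIdempotents_of_sum_eq_one (fun _ => he.isStarProjection _) <| by
    rw [← Finset.sum_range, he.sum_eq_one]

theorem completeOrthogonalIdempotents_succ (he : IsRokhlinTower σ m δ e) :
    CompleteOrthogonalIdempotents fun j : Fin m => e (j + 1) :=
  completeOrthogonalIdempotents_of_sum_eq_one (fun _ => he.isStarProjection _) <| by
    rw [← Finset.sum_range fun j => e (j + 1), ← sum_range_eq_sum_range_succ he.periodic.eq,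
      he.sum_eq_one]

theorem map_sum_mul_sub (he : IsRokhlinTower σ m δ e) {a : ℕ → B} {w : B} (ha : a m = a 0)
    (hw : ∀ j, Commute w (σ (e j))) :
    σ (∑ j : Fin m, a j * e j) * w - ∑ j : Fin m, a j * e j =
      ∑ j ∈ Finset.range m, σ (a j) * w * (σ (e j) - e (j + 1)) +
        ∑ j : Fin m, (σ (a j) * w - a (j + 1)) * e (j + 1) := by
  have wrap : a m * e m = a 0 * e 0 := by rw [ha, he.periodic.eq]
  rw [← Finset.sum_range fun j => a j * e j,
    ← Finset.sum_range fun j => (σ (a j) * w - a (j + 1)) * e (j + 1)]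
  nth_rw 2 [sum_range_eq_sum_range_succ (x := fun j => a j * e j) wrap]
  rw [map_sum, Finset.sum_mul, ← Finset.sum_sub_distrib, ← Finset.sum_add_distrib]
  refine Finset.sum_congr rfl fun j _ => ?_
  rw [map_mul, mul_assoc, ← (hw j).eq, mul_sub, sub_mul, ← mul_assoc, sub_add_sub_cancel]

theorem norm_map_sum_mul_sub_le [Nontrivial B] (he : IsRokhlinTower σ m δ e) {a : ℕ → B} {w : B}
    (ha : a m = a 0) (hw : ∀ j, Commute w (σ (e j))) {η : ℝ} (hη : 0 ≤ η)
    (hbound : ∀ j < m, ‖σ (a j) * w‖ ≤ 1) (hclose : ∀ j < m, ‖σ (a j) * w - a (j + 1)‖ ≤ η)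
    (hcomm : ∀ j < m, Commute (σ (a j) * w - a (j + 1)) (e (j + 1))) :
    ‖σ (∑ j : Fin m, a j * e j) * w - ∑ j : Fin m, a j * e j‖ ≤ m * δ + η := by
  rw [he.map_sum_mul_sub ha hw]
  refine (norm_add_le _ _).trans (add_le_add ?_ ?_)
  · refine (norm_sum_le_of_le (n := fun _ => δ) _ fun j hj => ?_).trans_eq ?_
    · exact (norm_mul_le_of_norm_le_one_left (hbound j (Finset.mem_range.mp hj)) _).trans
        (he.norm_map_sub_lt j).le
    · rw [Finset.sum_const, Finset.card_range, nsmul_eq_mul]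
  · exact norm_sum_mul_le_of_commute he.completeOrthogonalIdempotents_succ
      (fun j => (he.isStarProjection _).isSelfAdjoint) (fun j => hcomm j j.2) hη
      fun j => hclose j j.2

end IsRokhlinTower

/-- A unitary cocycle for the powers of `σ`: `W j` is determined by `W 1` and intertwines `σ ^ j`
with the `j`-th power of the perturbed endomorphism. -/
structure IsUnitaryCocycle (σ : B →⋆ₐ[ℂ] B) (W : ℕ → B) : Prop where
  mem_unitary : ∀ j, W j ∈ unitary B
  apply_zero : W 0 = 1
  map_apply_mul : ∀ j, σ (W j) * W 1 = W (j + 1)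

theorem map_mem_unitary {C : Type*} [CStarAlgebra C] (φ : B →⋆ₐ[ℂ] C) {U : B}
    (hU : U ∈ unitary B) : φ U ∈ unitary C := by
  rw [Unitary.mem_iff] at hU ⊢
  rw [← map_star, ← map_mul, ← map_mul, hU.1, hU.2, map_one, and_self]

theorem exists_unitary_steps_mem_eventualCommutant {σ : B →⋆ₐ[ℂ] B} {U : B} (hU : U ∈ unitary B)
    (hU_mem : U ∈ eventualCommutant σ) (hfin : (spectrum ℂ U).Finite) {m : ℕ} (hm : m ≠ 0) :
    ∃ y : ℕ → B, y 0 = U ∧ y m = 1 ∧ (∀ j, y j ∈ unitary B) ∧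
      (∀ j, ‖y j - y (j + 1)‖ ≤ Real.pi / m) ∧ ∀ j, y j ∈ eventualCommutant σ := by
  obtain ⟨y, hy_zero, hy_last, hy_unitary, hy_step, hy_comm⟩ := exists_unitary_steps hU hfin hm
  obtain ⟨K, hK, hK'⟩ : ∃ K, (∀ z, Commute U ((σ ^ K) z)) ∧ ∀ z, Commute (star U) ((σ ^ K) z) := by
    obtain ⟨K, hK⟩ := hU_mem
    refine ⟨K, hK, fun z => ?_⟩
    rw [← star_star z, map_star]
    exact (hK (star z)).star_star
  exact ⟨y, hy_zero, hy_last, hy_unitary, hy_step,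
    fun j => ⟨K, fun z => hy_comm j _ (hK z) (hK' z)⟩⟩

namespace IsUnitaryCocycle

variable {σ : B →⋆ₐ[ℂ] B} {W : ℕ → B}

/-- Take `σ ^ j (y j) * W j` for a path `y` of short steps from `W m` to `1`: it closes up after `m`
steps because `y 0 * W 0 = W m = y m * W m`. -/
theorem exists_closed_unitary_path [Nontrivial B] (hW : IsUnitaryCocycle σ W)
    (hW_mem : ∀ j, W j ∈ eventualCommutant σ) {m : ℕ} (hm : m ≠ 0)
    (hfin : (spectrum ℂ (W m)).Finite) :
    ∃ a : ℕ → B, a m = a 0 ∧ (∀ j, a j ∈ unitary B) ∧ (∀ j, a j ∈ eventualCommutant σ) ∧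
      ∀ j, ‖σ (a j) * W 1 - a (j + 1)‖ ≤ Real.pi / m := by
  obtain ⟨y, hy_zero, hy_last, hy_unitary, hy_step, hy_mem⟩ :=
    exists_unitary_steps_mem_eventualCommutant (hW.mem_unitary m) (hW_mem m) hfin hm
  refine ⟨fun j => (σ ^ j) (y j) * W j, ?_, fun j => ?_, fun j => ?_, fun j => ?_⟩
  · simp only [hy_zero, hy_last, hW.apply_zero, map_one, one_mul, mul_one, pow_zero]
    rfl
  · exact mul_mem (map_mem_unitary (σ ^ j) (hy_unitary j)) (hW.mem_unitary j)
  · exact mul_mem (map_pow_mem_eventualCommutant (hy_mem j) j) (hW_mem j)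
  · have map_pow_apply : σ ((σ ^ j) (y j)) = (σ ^ (j + 1)) (y j) := by
      rw [pow_succ']
      rfl
    rw [map_mul, mul_assoc, hW.map_apply_mul, map_pow_apply, ← sub_mul, ← map_sub]
    exact (norm_mul_le_of_norm_le_one_right
      (CStarRing.norm_of_mem_unitary (hW.mem_unitary (j + 1))).le _).trans
      ((NonUnitalStarAlgHom.norm_apply_le (σ ^ (j + 1)) _).trans (hy_step j))

theorem exists_unitary_norm_map_mul_sub_le [Nontrivial B] (hW : IsUnitaryCocycle σ W)
    (hW_mem : ∀ j, W j ∈ eventualCommutant σ) {m : ℕ} (hm : m ≠ 0)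
    (hfin : (spectrum ℂ (W m)).Finite) {δ : ℝ} {e : ℕ → B} (he : IsRokhlinTower σ m δ e) :
    ∃ v ∈ unitary B, ‖σ v * W 1 - v‖ ≤ m * δ + Real.pi / m := by
  obtain ⟨a, a_closed, a_unitary, a_mem, a_step⟩ := hW.exists_closed_unitary_path hW_mem hm hfin
  have map_a_mul_mem (j) : σ (a j) * W 1 - a (j + 1) ∈ eventualCommutant σ :=
    sub_mem (mul_mem (map_mem_eventualCommutant (a_mem j)) (hW_mem 1)) (a_mem (j + 1))
  obtain ⟨K, hK⟩ := exists_forall_commute_of_mem_eventualCommutant (Finset.range m)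
    fun j _ => a_mem j
  obtain ⟨L, hL⟩ := exists_forall_commute_of_mem_eventualCommutant (Finset.range m)
    fun j _ => map_a_mul_mem j
  obtain ⟨N, hN⟩ := hW_mem 1
  set M := max K (max L N)
  set E : ℕ → B := fun j => (σ ^ M) (e j)
  have hE : IsRokhlinTower σ m δ E := he.map_pow M
  have map_E (j) : σ (E j) = (σ ^ M) (σ (e j)) := by
    simpa using pow_apply_comm (σ := σ) 1 M (e j)
  refine ⟨∑ j : Fin m, a j * E j, sum_mul_mem_unitary hE.completeOrthogonalIdempotents
    (fun j => (hE.isStarProjection j).isSelfAdjoint) (fun j => a_unitary j) fun j i => ?_,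
    hE.norm_map_sum_mul_sub_le a_closed (fun j => ?_) (by positivity) (fun j _ => ?_)
    (fun j _ => a_step j) fun j hj => ?_⟩
  · exact commute_pow_apply_of_le (hK j (Finset.mem_range.mpr j.2)) (le_max_left _ _) _
  · rw [map_E]
    exact commute_pow_apply_of_le hN (le_max_of_le_right (le_max_right _ _)) _
  · exact (CStarRing.norm_of_mem_unitary
      (mul_mem (map_mem_unitary σ (a_unitary j)) (hW.mem_unitary 1))).le
  · exact commute_pow_apply_of_le (hL j (Finset.mem_range.mpr hj))
      (le_max_of_le_right (le_max_left _ _)) _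

theorem exists_unitary_norm_map_mul_sub_lt [Nontrivial B] (hW : IsUnitaryCocycle σ W)
    (hW_mem : ∀ j, W j ∈ eventualCommutant σ) (hfin : ∀ j, (spectrum ℂ (W j)).Finite)
    (htower : ∀ k, ∀ δ > 0, ∃ e, IsRokhlinTower σ (2 ^ k) δ e) {ε : ℝ} (hε : 0 < ε) :
    ∃ v ∈ unitary B, ‖σ v * W 1 - v‖ < ε := by
  obtain ⟨k, hk⟩ := pow_unbounded_of_one_lt (2 * Real.pi / ε) one_lt_two
  have pi_div_lt : Real.pi / 2 ^ k < ε / 2 := by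
    rw [div_lt_iff₀ hε] at hk
    rw [div_lt_iff₀ (by positivity)]
    linarith
  obtain ⟨e, he⟩ := htower k (ε / 2 / 2 ^ k) (by positivity)
  obtain ⟨v, hv, hle⟩ := hW.exists_unitary_norm_map_mul_sub_le hW_mem (pow_ne_zero k two_ne_zero)
    (hfin _) he
  refine ⟨v, hv, hle.trans_lt ?_⟩
  push_cast
  rw [mul_div_cancel₀ _ (by positivity : (2 : ℝ) ^ k ≠ 0)]
  linarith

end IsUnitaryCocycle

end Coboundary

/-! ### Words in a Cuntz family -/

/-- The product of the generators `s` along a word in their indices. -/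
def word {B ι : Type*} [Monoid B] (s : ι → B) (μ : List ι) : B := (μ.map s).prod

section Word

variable {B ι : Type*} [Monoid B] (s : ι → B)

@[simp]
theorem word_nil : word s [] = 1 := rfl

@[simp]
theorem word_cons (i : ι) (μ : List ι) : word s (i :: μ) = s i * word s μ :=
  List.prod_cons

theorem word_append (μ ν : List ι) : word s (μ ++ ν) = word s μ * word s ν := by
  rw [word, List.map_append, List.prod_append, word, word]

end Word

namespace IsCuntzFamily

variable {B ι κ : Type*} [CStarAlgebra B] [Fintype ι] [DecidableEq ι] [Fintype κ] [DecidableEq κ]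
  {s : ι → B} {t : κ → B}

theorem comp_equiv (h : IsCuntzFamily s) (e : κ ≃ ι) : IsCuntzFamily (s ∘ e) where
  star_mul_eq i j := by simp only [Function.comp_apply, h.star_mul_eq, e.apply_eq_iff_eq]
  sum_mul_star := (Equiv.sum_comp e fun i => s i * star (s i)).trans h.sum_mul_star

theorem mul (hs : IsCuntzFamily s) (ht : IsCuntzFamily t) :
    IsCuntzFamily fun p : ι × κ => s p.1 * t p.2 where
  star_mul_eq p q := by
    rw [star_mul, mul_assoc, hs.star_mul_mul, mul_ite, ht.star_mul_eq, mul_zero, ← ite_and]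
    simp only [Prod.ext_iff]
  sum_mul_star := by
    simp only [Fintype.sum_prod_type, star_mul, mul_assoc, ← Finset.mul_sum]
    simp only [← mul_assoc (t _), ← Finset.sum_mul, ht.sum_mul_star, one_mul, hs.sum_mul_star]

theorem isCuntzFamily_word (h : IsCuntzFamily s) (K : ℕ) :
    IsCuntzFamily fun ρ : Fin K → ι => word s (List.ofFn ρ) := by
  induction K with
  | zero => exact ⟨fun i j => by simp [Subsingleton.elim i j], by simp⟩
  | succ K ih =>
    convert (h.mul ih).comp_equiv (Fin.consEquiv fun _ => ι).symm using 2 with ρ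
    rw [List.ofFn_succ, word_cons]
    rfl

theorem endo_isCuntzFamily_word (h : IsCuntzFamily s) (K : ℕ) (x : B) :
    (h.isCuntzFamily_word K).endo x = (h.endo ^ K) x := by
  induction K with
  | zero =>
    change (h.isCuntzFamily_word 0).endo x = x
    simp [endo_apply]
  | succ K ih =>
    have pow_apply : (h.endo ^ (K + 1)) x = h.endo ((h.endo ^ K) x) := by
      rw [pow_succ']
      rfl
    rw [pow_apply, ← ih]
    simp only [endo_apply, Finset.mul_sum, Finset.sum_mul]
    rw [← (Fin.consEquiv fun _ => ι).sum_comp, Fintype.sum_prod_type]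
    simp [List.ofFn_succ, Fin.consEquiv, mul_assoc]

/-- The copy of the matrix algebra of size `|ι| ^ K` spanned by the products `s_μ s_ν^*` for words
`μ` and `ν` of length `K`. -/
noncomputable def level (h : IsCuntzFamily s) (K : ℕ) : StarSubalgebra ℂ B :=
  (h.isCuntzFamily_word K).matrixHom.range

theorem word_mul_star_word_mem_level (h : IsCuntzFamily s) {K : ℕ} {μ ν : List ι}
    (hμ : μ.length = K) (hν : ν.length = K) : word s μ * star (word s ν) ∈ h.level K := by
  subst hμ
  refine ⟨Matrix.single μ.get (ν.get ∘ Fin.cast hν.symm) 1, ?_⟩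
  have ofFn_cast : List.ofFn (ν.get ∘ Fin.cast hν.symm) = ν := by
    conv_rhs => rw [← List.ofFn_get ν, List.ofFn_congr hν]
    rfl
  exact (matrixHom_single _ _ _).trans (by rw [ofFn_cast, List.ofFn_get])

theorem isIntegral_of_mem_level (h : IsCuntzFamily s) {K : ℕ} {x : B} (hx : x ∈ h.level K) :
    IsIntegral ℂ x := by
  obtain ⟨M, rfl⟩ := hx
  exact (Algebra.IsIntegral.isIntegral M).map (h.isCuntzFamily_word K).matrixHom

theorem level_le_iff (h : IsCuntzFamily s) {K : ℕ} {S : StarSubalgebra ℂ B} :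
    h.level K ≤ S ↔ ∀ ρ τ : Fin K → ι,
      word s (List.ofFn ρ) * star (word s (List.ofFn τ)) ∈ S := by
  refine ⟨fun hS ρ τ => hS (h.word_mul_star_word_mem_level List.length_ofFn List.length_ofFn),
    fun hS => ?_⟩
  rintro _ ⟨M, rfl⟩
  exact sum_mem fun ρ _ => sum_mem fun τ _ => SMulMemClass.smul_mem _ (hS ρ τ)

theorem level_le_eventualCommutant (h : IsCuntzFamily s) (K : ℕ) :
    h.level K ≤ eventualCommutant h.endo :=
  h.level_le_iff.mpr fun ρ τ => ⟨K, fun y => by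
    rw [← endo_isCuntzFamily_word]
    exact (h.isCuntzFamily_word K).commute_endo y ρ τ⟩

theorem level_mono (h : IsCuntzFamily s) : Monotone h.level := by
  refine monotone_nat_of_le_succ fun K => h.level_le_iff.mpr fun ρ τ => ?_
  have expand : word s (List.ofFn ρ) * star (word s (List.ofFn τ)) =
      ∑ i, word s (List.ofFn ρ ++ [i]) * star (word s (List.ofFn τ ++ [i])) := by
    have regroup (i : ι) : word s (List.ofFn ρ ++ [i]) * star (word s (List.ofFn τ ++ [i])) =
        word s (List.ofFn ρ) * (s i * star (s i)) * star (word s (List.ofFn τ)) := by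
      simp only [word_append, word_cons, word_nil, mul_one, star_mul, mul_assoc]
    simp only [regroup, ← Finset.sum_mul, ← Finset.mul_sum, h.sum_mul_star, mul_one]
  rw [expand]
  exact sum_mem fun i _ => h.word_mul_star_word_mem_level (by simp) (by simp)

theorem endo_pow_word_mul_star_mem_level (h : IsCuntzFamily s) (μ : List ι) (j : ℕ) :
    (h.endo ^ j) (word s μ) * star (word s μ) ∈ h.level (j + μ.length) := by
  rw [← endo_isCuntzFamily_word, endo_apply, Finset.sum_mul]
  refine sum_mem fun ρ _ => ?_
  have regroup : word s (List.ofFn ρ) * word s μ * star (word s (List.ofFn ρ)) * star (word s μ) =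
      word s (List.ofFn ρ ++ μ) * star (word s (μ ++ List.ofFn ρ)) := by
    simp only [word_append, star_mul, mul_assoc]
  rw [regroup]
  exact h.word_mul_star_word_mem_level (by simp) (by simp [add_comm])

end IsCuntzFamily

/-! ### Transport of Cuntz families -/

section Transport

variable {B κ : Type*} [CStarAlgebra B] [Fintype κ]

/-- The unitary carrying the Cuntz family `t` to its image under `σ ^ j`. -/
noncomputable def transport (σ : B →⋆ₐ[ℂ] B) (t : κ → B) (j : ℕ) : B :=
  ∑ k, (σ ^ j) (t k) * star (t k)

namespace IsCuntzFamily

theorem exists_transport_word_mem_level {ι : Type*} [Fintype ι] [DecidableEq ι] {s : ι → B}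
    (h : IsCuntzFamily s) (μ : κ → List ι) (j : ℕ) :
    ∃ K, transport h.endo (fun k => word s (μ k)) j ∈ h.level K :=
  ⟨j + ∑ k, (μ k).length, sum_mem fun k hk =>
    h.level_mono (Nat.add_le_add_left
      (Finset.single_le_sum (f := fun k => (μ k).length) (fun _ _ => Nat.zero_le _) hk) j)
      (h.endo_pow_word_mul_star_mem_level (μ k) j)⟩

variable [DecidableEq κ] {t : κ → B}

theorem map {C : Type*} [CStarAlgebra C] (h : IsCuntzFamily t) (φ : B →⋆ₐ[ℂ] C) :
    IsCuntzFamily fun k => φ (t k) where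
  star_mul_eq i j := by rw [← map_star, ← map_mul, h.star_mul_eq, apply_ite φ, map_one, map_zero]
  sum_mul_star := by simp only [← map_star, ← map_mul, ← map_sum, h.sum_mul_star, map_one]

theorem sum_mul_star_mem_unitary {t' : κ → B} (h' : IsCuntzFamily t') (h : IsCuntzFamily t) :
    ∑ k, t' k * star (t k) ∈ unitary B := by
  have star_mul_self {a b : κ → B} (ha : IsCuntzFamily a) (hb : IsCuntzFamily b) :
      (∑ k, a k * star (b k)) * (∑ k, b k * star (a k)) = 1 := by
    simp only [Finset.sum_mul_sum, mul_assoc, hb.star_mul_mul, mul_ite, mul_zero,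
      Finset.sum_ite_eq, Finset.mem_univ, if_true, ha.sum_mul_star]
  have star_sum_eq : star (∑ k, t' k * star (t k)) = ∑ k, t k * star (t' k) := by
    simp only [star_sum, star_mul, star_star]
  rw [Unitary.mem_iff, star_sum_eq]
  exact ⟨star_mul_self h h', star_mul_self h' h⟩

theorem transport_mul (h : IsCuntzFamily t) (σ : B →⋆ₐ[ℂ] B) (j : ℕ) (k : κ) :
    transport σ t j * t k = (σ ^ j) (t k) := by
  simp [transport, Finset.sum_mul, mul_assoc, h.star_mul_eq]

theorem isUnitaryCocycle_transport (h : IsCuntzFamily t) (σ : B →⋆ₐ[ℂ] B) :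
    IsUnitaryCocycle σ (transport σ t) where
  mem_unitary j := (h.map (σ ^ j)).sum_mul_star_mem_unitary h
  apply_zero := h.sum_mul_star
  map_apply_mul j := by
    have map_transport : σ (transport σ t j) = ∑ k, (σ ^ (j + 1)) (t k) * star (σ (t k)) := by
      simp only [transport, map_sum, _root_.map_mul, map_star, pow_succ']
      rfl
    have star_map_mul (k : κ) : star (σ (t k)) * transport σ t 1 = star (t k) := by
      simp [transport, Finset.mul_sum, ← mul_assoc, (h.map σ).star_mul_eq]
    simp only [map_transport, Finset.sum_mul, mul_assoc, star_map_mul]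
    rfl

end IsCuntzFamily

end Transport

/-! ### Central matrix units in algebras generated by two Cuntz isometries -/

namespace IsCuntzFamily

section

variable {B ι : Type*} [CStarAlgebra B] [Fintype ι] [DecidableEq ι] {s : ι → B}

theorem commute_matrixHom_endo (h : IsCuntzFamily s) (M : Matrix ι ι ℂ) (y : B) :
    Commute (h.matrixHom M) (h.endo y) :=
  .sum_left _ _ _ fun i _ => .sum_left _ _ _ fun j _ => (h.commute_endo y i j).smul_left _

theorem norm_le_one (h : IsCuntzFamily s) (k : ι) : ‖s k‖ ≤ 1 := by
  have norm_sq_le : ‖s k‖ * ‖s k‖ ≤ 1 := by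
    rw [← CStarRing.norm_star_mul_self, h.star_mul_eq, if_pos rfl]
    exact (IsStarProjection.one B).norm_le
  exact (pow_le_one_iff_of_nonneg (norm_nonneg _) two_ne_zero).mp ((sq _).trans_le norm_sq_le)

theorem norm_mul_sub_mul_le (h : IsCuntzFamily s) (x : B) (k : ι) :
    ‖x * s k - s k * x‖ ≤ ‖h.endo x - x‖ := by
  rw [← h.endo_mul, ← sub_mul, norm_sub_rev]
  exact norm_mul_le_of_norm_le_one_right (h.norm_le_one k) _

theorem map_matrixHom (h : IsCuntzFamily s) (σ : B →⋆ₐ[ℂ] B) (M : Matrix ι ι ℂ) :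
    σ (h.matrixHom M) = transport σ s 1 * h.matrixHom M * star (transport σ s 1) := by
  have map_eq (k : ι) : σ (s k) = transport σ s 1 * s k := (h.transport_mul σ 1 k).symm
  simp only [matrixHom_apply, map_sum, map_smul, _root_.map_mul, map_star, map_eq, star_mul,
    Finset.mul_sum, Finset.sum_mul, mul_smul_comm, smul_mul_assoc, mul_assoc]

end

section Pair

variable {B : Type*} [CStarAlgebra B] {s : Fin 2 → B}

theorem fin_cons {n : ℕ} {t : Fin n → B} (hs : IsCuntzFamily s) (ht : IsCuntzFamily t) :
    IsCuntzFamily (Fin.cons (s 0) fun k => s 1 * t k : Fin (n + 1) → B) where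
  star_mul_eq i j := by
    refine Fin.cases ?_ (fun i => ?_) i <;> refine Fin.cases ?_ (fun j => ?_) j
    · simp [hs.star_mul_eq]
    · simp [hs.star_mul_mul, (Fin.succ_ne_zero j).symm]
    · simp [hs.star_mul_eq, mul_assoc]
    · simp [hs.star_mul_mul, ht.star_mul_eq, mul_assoc]
  sum_mul_star := by
    have regroup (k : Fin n) :
        s 1 * t k * star (s 1 * t k) = s 1 * (t k * star (t k)) * star (s 1) := by
      simp only [star_mul, mul_assoc]
    simp only [Fin.sum_univ_succ, Fin.cons_zero, Fin.cons_succ, regroup, ← Finset.sum_mul,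
      ← Finset.mul_sum, ht.sum_mul_star, mul_one]
    exact (Fin.sum_univ_two fun i => s i * star (s i)).symm.trans hs.sum_mul_star

theorem exists_words (h : IsCuntzFamily s) (n : ℕ) :
    ∃ μ : Fin (n + 1) → List (Fin 2), IsCuntzFamily fun k => word s (μ k) := by
  induction n with
  | zero => exact ⟨fun _ => [], fun i j => by simp [Fin.fin_one_eq_zero], by simp⟩
  | succ n ih =>
    obtain ⟨μ, hμ⟩ := ih
    refine ⟨Fin.cons [0] fun k => 1 :: μ k, ?_⟩
    convert h.fin_cons hμ using 1
    ext k
    refine Fin.cases ?_ (fun k => ?_) k <;> simp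

variable [Nontrivial B]

/-- The Pauli matrices in the copy of `M_2` with matrix units `s_i s_j^*` play the role of `X` and
`Z`. -/
theorem exists_endo_flipped_projection (h : IsCuntzFamily s) {q : ℕ} (hq : q ≠ 0) {ε : ℝ}
    (hε : 0 < ε) : ∃ p ∈ eventualCommutant h.endo,
      IsStarProjection p ∧ ‖(h.endo ^ q) p - (1 - p)‖ < ε := by
  set σx : Matrix (Fin 2) (Fin 2) ℂ := !![0, 1; 1, 0]
  set σz : Matrix (Fin 2) (Fin 2) ℂ := !![1, 0; 0, -1]
  have selfAdjoint {M : Matrix (Fin 2) (Fin 2) ℂ} (hM : M.IsHermitian) :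
      IsSelfAdjoint (h.matrixHom M) := hM.isSelfAdjoint.map h.matrixHom
  have σx_hermitian : σx.IsHermitian := by
    ext i j; fin_cases i <;> fin_cases j <;> simp [σx]
  have σz_hermitian : σz.IsHermitian := by
    ext i j; fin_cases i <;> fin_cases j <;> simp [σz]
  have σx_sq : σx * σx = 1 := by simp [σx, Matrix.one_fin_two]
  have σz_sq : σz * σz = 1 := by simp [σz, Matrix.one_fin_two]
  have σx_mul_σz : σx * σz = -(σz * σx) := by simp [σx, σz]
  have commute (M : Matrix (Fin 2) (Fin 2) ℂ) (y : B) :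
      Commute (h.matrixHom M) ((h.endo ^ q) y) := by
    obtain ⟨q, rfl⟩ := Nat.exists_eq_succ_of_ne_zero hq
    rw [Nat.succ_eq_add_one, pow_succ']
    exact h.commute_matrixHom_endo M ((h.endo ^ q) y)
  obtain ⟨p, p_mem, hp, hp_flip⟩ := exists_flipped_projection (σ := h.endo ^ q)
    (selfAdjoint σx_hermitian) (by rw [← map_mul, σx_sq, map_one])
    (selfAdjoint σz_hermitian) (by rw [← map_mul, σz_sq, map_one])
    (by rw [← map_mul h.matrixHom, σx_mul_σz, map_neg, map_mul]) (commute σx) (commute σz) hε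
  exact ⟨p, eventualCommutant_pow_le q p_mem, hp, hp_flip⟩

theorem exists_unitary_norm_endo_mul_transport_sub_lt {κ : Type*} [Fintype κ] [DecidableEq κ]
    (h : IsCuntzFamily s) {μ : κ → List (Fin 2)} (ht : IsCuntzFamily fun k => word s (μ k))
    {ε : ℝ} (hε : 0 < ε) :
    ∃ v ∈ unitary B, ‖h.endo v * transport h.endo (fun k => word s (μ k)) 1 - v‖ < ε := by
  refine (ht.isUnitaryCocycle_transport h.endo).exists_unitary_norm_map_mul_sub_lt
    (fun j => ?_) (fun j => ?_) (fun k δ hδ => ?_) hε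
  · obtain ⟨K, hK⟩ := h.exists_transport_word_mem_level μ j
    exact h.level_le_eventualCommutant K hK
  · obtain ⟨K, hK⟩ := h.exists_transport_word_mem_level μ j
    exact finite_spectrum_of_isIntegral (h.isIntegral_of_mem_level hK)
  · obtain ⟨e, he, -⟩ := exists_isRokhlinTower_two_pow
      (fun q hq ε hε => h.exists_endo_flipped_projection hq hε) k hδ
    exact ⟨e, he⟩

end Pair

end IsCuntzFamily

section

variable {B : Type*} [CStarAlgebra B]

theorem norm_conj_sub_conj_le {u v p : B} (hu : u ∈ unitary B) (hv : v ∈ unitary B)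
    (hp : ‖p‖ ≤ 1) : ‖u * p * star u - v * p * star v‖ ≤ 2 * ‖u - v‖ := by
  calc ‖u * p * star u - v * p * star v‖
      = ‖(u - v) * p * star u + v * (p * star (u - v))‖ := by
        rw [star_sub, mul_sub, mul_sub, sub_mul, sub_mul, ← mul_assoc v, ← mul_assoc v,
          sub_add_sub_cancel]
    _ ≤ ‖u - v‖ + ‖u - v‖ := by
        refine norm_add_le_of_le ?_ ?_
        · rw [CStarRing.norm_mul_mem_unitary _ (Unitary.star_mem hu)]
          exact norm_mul_le_of_norm_le_one_right hp _
        · rw [CStarRing.norm_mem_unitary_mul _ hv, ← norm_star (u - v)]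
          exact norm_mul_le_of_norm_le_one_left hp _
    _ = 2 * ‖u - v‖ := (two_mul _).symm

/-- Conjugating matrix units `t_i t_j^*` by a unitary `v` that almost trivialises the transport of
`t` makes them almost fixed by the canonical endomorphism, hence almost central. -/
theorem IsCuntzFamily.exists_matrixHom_norm_mul_sub_mul_lt [Nontrivial B] {s : Fin 2 → B}
    (h : IsCuntzFamily s) (n : ℕ) [NeZero n] {ε : ℝ} (hε : 0 < ε) :
    ∃ φ : Matrix (Fin n) (Fin n) ℂ →⋆ₐ[ℂ] B, ∀ i j k,
      ‖φ (Matrix.single i j 1) * s k - s k * φ (Matrix.single i j 1)‖ < ε := by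
  obtain ⟨n, rfl⟩ := Nat.exists_eq_succ_of_ne_zero (NeZero.ne n)
  obtain ⟨μ, ht⟩ := h.exists_words n
  obtain ⟨v, hv, v_close⟩ := h.exists_unitary_norm_endo_mul_transport_sub_lt ht (half_pos hε)
  refine ⟨(Unitary.conjStarAlgAut ℂ B ⟨v, hv⟩ : B →⋆ₐ[ℂ] B).comp ht.matrixHom, fun i j k => ?_⟩
  set p := ht.matrixHom (Matrix.single i j 1)
  set U := transport h.endo (fun k => word s (μ k)) 1
  have map_conj : h.endo (v * p * star v) = h.endo v * U * p * star (h.endo v * U) := by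
    rw [map_mul, map_mul, ht.map_matrixHom, star_mul, map_star]
    simp only [mul_assoc, U, p]
  have hvU : h.endo v * U ∈ unitary B :=
    mul_mem (map_mem_unitary _ hv) ((ht.isUnitaryCocycle_transport h.endo).mem_unitary 1)
  calc _ ≤ ‖h.endo (v * p * star v) - v * p * star v‖ := h.norm_mul_sub_mul_le (v * p * star v) k
    _ ≤ 2 * ‖h.endo v * U - v‖ := map_conj ▸
        norm_conj_sub_conj_le hvU hv (norm_map_single_le_one ht.matrixHom i j)
    _ < ε := by linarith

end

/-! ### The Cuntz algebra `𝒪₂` -/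

section CuntzTwo

theorem blockIsometry_two_mem_cuntzTwo (i : Fin 2) : blockIsometry 2 i ∈ cuntzTwo := by
  refine StarSubalgebra.le_topologicalClosure _ (StarAlgebra.subset_adjoin ℂ _ ?_)
  fin_cases i
  · exact Or.inl rfl
  · exact Or.inr rfl

/-- The canonical generators of `𝒪₂`. -/
noncomputable def cuntzTwoGen (i : Fin 2) : cuntzTwo :=
  ⟨blockIsometry 2 i, blockIsometry_two_mem_cuntzTwo i⟩

theorem isCuntzFamily_cuntzTwoGen : IsCuntzFamily cuntzTwoGen where
  star_mul_eq i j := Subtype.ext <|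
    ((isCuntzFamily_blockIsometry 2).star_mul_eq i j).trans (by split_ifs <;> rfl)
  sum_mul_star := Subtype.ext <| by
    have := (isCuntzFamily_blockIsometry 2).sum_mul_star
    rw [Fin.sum_univ_two] at this ⊢
    exact this

instance : Nontrivial cuntzTwo :=
  ⟨1, 0, fun h => stdBasis.orthonormal.ne_zero 0
    (DFunLike.congr_fun (congrArg Subtype.val h) (stdBasis 0))⟩

theorem hasCentralMatrixUnits_cuntzTwo (n : ℕ) [NeZero n] : HasCentralMatrixUnits n cuntzTwo := by
  refine hasCentralMatrixUnits_of_dense_adjoin _ (dense_adjoin_preimage_val _) fun F ε hF hε => ?_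
  obtain ⟨φ, hφ⟩ := isCuntzFamily_cuntzTwoGen.exists_matrixHom_norm_mul_sub_mul_lt n hε
  refine ⟨φ, fun i j a ha => ?_⟩
  obtain h | h := hF ha
  · exact (Subtype.ext h : a = cuntzTwoGen 0) ▸ hφ i j 0
  · exact (Subtype.ext h : a = cuntzTwoGen 1) ▸ hφ i j 1

end CuntzTwo

theorem mainTheorem4_general {A : Type*} [CStarAlgebra A] [Nontrivial A]
    (α : Circle →* (A ≃⋆ₐ[ℂ] A)) (hcont : ∀ a : A, Continuous fun ζ : Circle => α ζ a)
    (hα : CircleRokhlinProperty α) :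
    (TensoriallyAbsorbs A universalUHF →
      ∀ (n : ℕ) [NeZero n], FiniteRokhlinProperty (restrictCyclic α n)) ∧
    (TensoriallyAbsorbs A cuntzTwo →
      ∀ (n : ℕ) [NeZero n], FiniteRokhlinProperty (restrictCyclic α n)) :=
  ⟨fun h n _ => finiteRokhlinProperty_of_hasCentralMatrixUnits hα hcont n
      (hasCentralMatrixUnits_of_tensoriallyAbsorbs (hasCentralMatrixUnits_universalUHF n) h),
    fun h n _ => finiteRokhlinProperty_of_hasCentralMatrixUnits hα hcont n
      (hasCentralMatrixUnits_of_tensoriallyAbsorbs (hasCentralMatrixUnits_cuntzTwo n) h)⟩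

theorem mainTheorem4 {A : Type*} [CStarAlgebra A] [Nontrivial A]
    [TopologicalSpace.SeparableSpace A]
    (α : Circle →* (A ≃⋆ₐ[ℂ] A)) (hcont : ∀ a : A, Continuous fun ζ : Circle => α ζ a)
    (hα : CircleRokhlinProperty α) :
    (TensoriallyAbsorbs A universalUHF →
      ∀ (n : ℕ) [NeZero n], FiniteRokhlinProperty (restrictCyclic α n)) ∧
    (TensoriallyAbsorbs A cuntzTwo →
      ∀ (n : ℕ) [NeZero n], FiniteRokhlinProperty (restrictCyclic α n)) :=
  mainTheorem4_general α hcont hα
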